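/- **Setting.** Let $\mathbb X$ be a separable real Hilbert space and $\mathcal C$ a bounded operator on $\mathbb X$ with an orthonormal basis of eigenvectors $(e_i)_{i\ge1}$, $\mathcal C e_i=\lambda_i^{\mathcal C}e_i$, such that for some $\kappa>1/2$ and $C_1,C_2>0$ one has $C_1 i^{-\kappa}\le\sqrt{\lambda^{\mathcal C}_i}\le C_2 i^{-\kappa}$ for all $i\ge1$. For $s\in\mathbb R$ let $\mathbb X^s=\{(x_i)_{i\ge 1}:\sum_i i^{2s}x_i^2<\infty\}$ with its Hilbert norm; $\mathbb X^0$ is identified with $\mathbb X$ through the coordinates in the basis $(e_i)$, and $\mathcal C^{1/2}$ acts on sequences by multiplication of the $i$-th coordinate by $\sqrt{\lambda_i^{\mathcal C}}$. Let $0\le\ell<\kappa-\frac12$, and let $\mathcal G=(\mathcal G_1,\dots,\mathcal G_m):\mathbb X^\ell\to\mathbb R^m$ have Fréchet differentiable components on $\mathbb X^\ell$ (the derivatives are then elements of $\mathbb X^{-\ell}$, the dual of $\mathbb X^\ell$ under the pairing of coordinates). Let $y\in\mathbb R^m$, let $\Sigma\in\mathbb R^{m\times m}$ be symmetric positive definite,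 and let $\Phi(u)=\frac12\langle y-\mathcal G(u),\Sigma^{-1}(y-\mathcal G(u))\rangle$. The whitened unknown is $v=\mathcal C^{-1/2}u\in\mathbb X^{\ell-\kappa}$, and we write $\Phi(v)=\Phi(\mathcal C^{1/2}v)$. Let $\mu_0=\mathcal N(0,\mathcal I)$ be the law of a sequence of independent standard normal variables, regarded as a measure on $\mathbb X^{\ell-\kappa}$; let $Z=\int e^{-\Phi}\,d\mu_0$ and let $\mu(dv)=Z^{-1}e^{-\Phi(v)}\mu_0(dv)$ be the posterior. Let $\nabla_v\Phi(v)=\mathcal C^{1/2}\nabla_u\Phi(u)\in\mathbb X$ and let $\mathcal H(v)=\mathcal C^{1/2}\,\nabla\mathcal G(u)^*\Sigma^{-1}\nabla\mathcal G(u)\,\mathcal C^{1/2}$, a bounded operator on $\mathbb X$, where $u=\mathcal C^{1/2}v$. Fix $r\ge0$. For every $v$ let $v_1(v),\dots,v_r(v)\in\mathbb X$ be orthonormal eigenvectors of $\mathcal H(v)$, chosen measurably in $v$, for its $r$ largest eigenvalues $\lambda_1(v)\ge\dots\ge\lambda_r(v)$. Write $\mathcal V_r w=\sum_{i\le r} w_iv_i$,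 $\mathcal V_r^*x=(\langle v_i,x\rangle)_{i\le r}$ with $\langle x,w\rangle=\sum_j\langle e_j,x\rangle w_j$ for $x\in\mathbb X$, $w\in\mathbb X^{\ell-\kappa}$, $\Lambda_r=\mathrm{diag}(\lambda_i)$, $D_r=(I_r+\Lambda_r)^{-1}$, $\hat{\mathcal H}=\mathcal V_r\Lambda_r\mathcal V_r^*$, $\hat{\mathcal K}=(\mathcal I+\hat{\mathcal H})^{-1}=\mathcal I+\mathcal V_r(D_r-I_r)\mathcal V_r^*$ and $\hat{\mathcal K}^{\pm1/2}=\mathcal I+\mathcal V_r(D_r^{\pm1/2}-I_r)\mathcal V_r^*$ (all depending on $v$; summands with $\lambda_i=0$ are zero in these operators). Let $|\hat{\mathcal K}^{-1/2}|$ be the determinant $\prod_{i\le r}(1+\lambda_i)^{1/2}$ of this finite-rank perturbation of the identity. For $\gamma_r,\gamma_\perp\in\{0,1\}$ let $s(\gamma)=\gamma_r\mathcal V_r\mathcal V_r^*+\gamma_\perp(\mathcal I-\mathcal V_r\mathcal V_r^*)$. For $h>0$ let $\rho_0=\frac{1-h/4}{1+h/4}$, $\rho_1=1-\rho_0$, $\rho_2=\sqrt{1-\rho_0^2}$.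 The DR-$\infty$-mMALA proposal is $$v'=(\rho_0\mathcal I-\rho_1\mathcal V_r(D_r-I_r)\mathcal V_r^*)v-\rho_1(\mathcal I+\mathcal V_r(D_r-I_r)\mathcal V_r^*)s(\gamma)\nabla_v\Phi(v)+\rho_2(\mathcal I+\mathcal V_r(\sqrt{D_r}-I_r)\mathcal V_r^*)\xi,\qquad \xi\sim\mathcal N(0,\mathcal I),$$ with all operators evaluated at $v$. Let $Q(v,\cdot)$ be the law of $v'$, let $\nu(dv,dv')=\mu(dv)Q(v,dv')$, and let $\nu^\top$ be its image under $(v,v')\mapsto(v',v)$. **Theorem.** The proposal is well-defined on $\mathbb X$ and the acceptance probability is explicit: 1. $\mu_0$ is a probability measure on $\mathbb X^{\ell-\kappa}$, the law of $u=\mathcal C^{1/2}v\in\mathbb X$ under $\mu_0$ is $\mathcal N(0,\mathcal C)$, $0<Z<\infty$, and $\mu$ is a probability measure. 2. The pairings $\langle v_i(v),w\rangle$ with $\lambda_i(v)\ne0$ and $\langle\hat{\mathcal K}(v)^{-1/2}\hat g(v),\hat{\mathcal K}(v)^{-1/2}w\rangle$ converge absolutely for all $v,w\in\mathbb X^{\ell-\kappa}$,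 and $Q$ is a Markov kernel on $\mathbb X^{\ell-\kappa}$. 3. $\nu$ and $\nu^\top$ are mutually absolutely continuous; the same holds for the image of $\nu$ on $\mathbb X\times\mathbb X$ under $(v,v')\mapsto(\mathcal C^{1/2}v,\mathcal C^{1/2}v')$ and its transpose. 4. For $\nu$-almost every $(v,v')$, the acceptance probability is $$a(v,v')=1\wedge\frac{d\nu^\top}{d\nu}(v,v')=1\wedge\frac{\kappa(v',v)}{\kappa(v,v')},\qquad \kappa(v,v')=\exp\{-\Phi(v)\}\,\lambda(w^*;v),\qquad w^*=\frac{v'-\rho_0v}{\rho_2},$$ $$\lambda(w;v)=\exp\Big\{-\tfrac h8\big|\hat{\mathcal K}(v)^{-\frac12}\hat g(v)\big|^2+\tfrac{\sqrt h}2\big\langle\hat{\mathcal K}(v)^{-\frac12}\hat g(v),\hat{\mathcal K}(v)^{-\frac12}w\big\rangle\Big\}\exp\Big\{-\tfrac12\langle w,\hat{\mathcal H}(v)w\rangle\Big\}\,\big|\hat{\mathcal K}(v)^{-1/2}\big|,$$ where $\hat g(v)=-\hat{\mathcal K}(v)\{-\hat{\mathcal H}(v)v+s(\gamma)\nabla_v\Phi(v)\}$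 (in $\kappa(v',v)$ the vector $w^*$ is $(v-\rho_0v')/\rho_2$). -/

import Mathlib

open MeasureTheory ProbabilityTheory Set
open scoped ENNReal NNReal RealInnerProductSpace

noncomputable section

namespace DRMala

/-! ### The scale of sequence spaces `X^s`

`X^s` consists of the real sequences `x` with `∑ i, i^(2s) |x_i|^2 < ∞`, normed by the square root
of this sum.  Sequences are indexed from `0`, so the weight `i` is written `i + 1`. -/

/-- The weights `i^s`, with the index starting at one. -/
def wt (s : ℝ) (i : ℕ) : ℝ := ((i : ℝ) + 1) ^ s

theorem wt_pos (s : ℝ) (i : ℕ) : 0 < wt s i := by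
  unfold wt; positivity

theorem wt_sq (s : ℝ) (i : ℕ) : wt s i ^ 2 = ((i : ℝ) + 1) ^ (2 * s) := by
  unfold wt
  rw [← Real.rpow_natCast, ← Real.rpow_mul (by positivity)]
  congr 1
  push_cast
  ring

theorem memlp_iff (s : ℝ) (x : ℕ → ℝ) :
    Memℓp (fun i => wt s i * x i) 2 ↔
      Summable fun i : ℕ => ((i : ℝ) + 1) ^ (2 * s) * x i ^ 2 := by
  rw [memℓp_gen_iff (by norm_num)]
  refine summable_congr fun i => ?_
  rw [← wt_sq, ← mul_pow]
  simp only [ENNReal.toReal_ofNat, Real.rpow_ofNat, Real.norm_eq_abs, sq_abs]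

/-- The linear space underlying `X^s`. -/
def sobolevSubmodule (s : ℝ) : Submodule ℝ (ℕ → ℝ) where
  carrier := {x | Summable fun i : ℕ => ((i : ℝ) + 1) ^ (2 * s) * x i ^ 2}
  zero_mem' := by simp [summable_zero]
  add_mem' := by
    intro x y hx hy
    simp only [mem_ofPred_eq] at hx hy ⊢
    rw [← memlp_iff] at hx hy ⊢
    convert hx.add hy using 1
    funext i
    simp [mul_add]
  smul_mem' := by
    intro c x hx
    simp only [mem_ofPred_eq] at hx ⊢
    rw [← memlp_iff] at hx ⊢
    convert hx.const_smul c using 1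
    funext i
    simp only [Pi.smul_apply, smul_eq_mul]
    ring

/-- The space `X^s`; a separate type, so that it carries the norm topology and not the topology
of coordinatewise convergence. -/
def SobolevSeq (s : ℝ) : Type := sobolevSubmodule s

instance (s : ℝ) : AddCommGroup (SobolevSeq s) := inferInstanceAs (AddCommGroup (sobolevSubmodule s))

instance (s : ℝ) : Module ℝ (SobolevSeq s) := inferInstanceAs (Module ℝ (sobolevSubmodule s))

instance (s : ℝ) : CoeFun (SobolevSeq s) (fun _ => ℕ → ℝ) := ⟨fun x => x.1⟩

/-- The linear map `x ↦ (i^s x_i)` from `X^s` to `ℓ²`, which defines the norm of `X^s`. -/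
def toEll2 (s : ℝ) : SobolevSeq s →ₗ[ℝ] lp (fun _ : ℕ => ℝ) 2 where
  toFun x := ⟨fun i => wt s i * x i, (memlp_iff s x).2 x.2⟩
  map_add' x y := by
    ext i
    exact mul_add (wt s i) (x i) (y i)
  map_smul' c x := by
    ext i
    exact mul_left_comm (wt s i) c (x i)

theorem toEll2_apply (s : ℝ) (x : SobolevSeq s) (i : ℕ) : toEll2 s x i = wt s i * x i := rfl

theorem toEll2_injective (s : ℝ) : Function.Injective (toEll2 s) := by
  intro x y hxy
  refine Subtype.ext (funext fun i => ?_)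
  have h : toEll2 s x i = toEll2 s y i := by rw [hxy]
  rw [toEll2_apply, toEll2_apply] at h
  exact mul_left_cancel₀ (wt_pos s i).ne' h

instance (s : ℝ) : NormedAddCommGroup (SobolevSeq s) :=
  NormedAddCommGroup.induced (SobolevSeq s) _ (toEll2 s) (toEll2_injective s)

instance (s : ℝ) : NormedSpace ℝ (SobolevSeq s) :=
  NormedSpace.induced ℝ (SobolevSeq s) _ (toEll2 s)

instance (s : ℝ) : MeasurableSpace (SobolevSeq s) := borel _

instance (s : ℝ) : BorelSpace (SobolevSeq s) := ⟨rfl⟩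

theorem norm_eq (s : ℝ) (x : SobolevSeq s) : ‖x‖ = ‖toEll2 s x‖ := rfl

theorem norm_sq_eq (s : ℝ) (x : SobolevSeq s) :
    ‖x‖ ^ 2 = ∑' i : ℕ, ((i : ℝ) + 1) ^ (2 * s) * x i ^ 2 := by
  have h := lp.norm_rpow_eq_tsum (p := 2) (by norm_num) (toEll2 s x)
  rw [norm_eq]
  norm_num at h
  rw [h]
  refine tsum_congr fun i => ?_
  rw [toEll2_apply, mul_pow, wt_sq]

theorem diag_bound {a b c K x : ℝ} (ha : 0 < a) (h : a * |c| ≤ K * b) :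
    a ^ 2 * (c * x) ^ 2 ≤ K ^ 2 * (b ^ 2 * x ^ 2) := by
  have h1 : (a * |c|) ^ 2 ≤ (K * b) ^ 2 := pow_le_pow_left₀ (by positivity) h 2
  have h2 := mul_le_mul_of_nonneg_right h1 (sq_nonneg x)
  rw [mul_pow, sq_abs] at h2
  linarith

theorem diag_mem {s t : ℝ} {c : ℕ → ℝ} (hc : ∃ K, ∀ i, wt t i * |c i| ≤ K * wt s i)
    (x : SobolevSeq s) : (fun i => c i * x i) ∈ sobolevSubmodule t := by
  obtain ⟨K, hK⟩ := hc
  refine Summable.of_nonneg_of_le (fun i => by positivity) (fun i => ?_) (x.2.mul_left (K ^ 2))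
  rw [← wt_sq, ← wt_sq]
  exact diag_bound (wt_pos t i) (hK i)

/-- The bounded map `X^s → X^t`, `x ↦ (c_i x_i)`, for multipliers with `i^t |c_i| ≤ K i^s`. -/
def diag (s t : ℝ) (c : ℕ → ℝ) (hc : ∃ K, ∀ i, wt t i * |c i| ≤ K * wt s i) :
    SobolevSeq s →L[ℝ] SobolevSeq t :=
  LinearMap.mkContinuousOfExistsBound
    { toFun := fun x => ⟨fun i => c i * x i, diag_mem hc x⟩
      map_add' := fun x y => Subtype.ext (funext fun i => mul_add (c i) (x i) (y i))
      map_smul' := fun a x => Subtype.ext (funext fun i => mul_left_comm (c i) a (x i)) }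
    (by
      obtain ⟨K, hK⟩ := hc
      have hK0 : 0 ≤ K := by
        have h0 := hK 0
        have h1 := wt_pos s 0
        have h2 := wt_pos t 0
        by_contra hneg
        have : 0 ≤ wt t 0 * |c 0| := by positivity
        nlinarith
      refine ⟨K, fun x => ?_⟩
      refine abs_le_of_sq_le_sq' ?_ (by positivity) |>.2
      rw [mul_pow, norm_sq_eq, norm_sq_eq, ← tsum_mul_left]
      refine Summable.tsum_le_tsum (fun i => ?_) (diag_mem ⟨K, hK⟩ x) (x.2.mul_left (K ^ 2))
      rw [← wt_sq, ← wt_sq]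
      exact diag_bound (wt_pos t i) (hK i))

theorem diag_apply (s t : ℝ) (c : ℕ → ℝ) (hc : ∃ K, ∀ i, wt t i * |c i| ≤ K * wt s i)
    (x : SobolevSeq s) (i : ℕ) : diag s t c hc x i = c i * x i := rfl

/-- The inclusion `X^s ⊆ X^t` for `t ≤ s`. -/
def incl (s t : ℝ) (h : t ≤ s) : SobolevSeq s →L[ℝ] SobolevSeq t :=
  diag s t (fun _ => 1) ⟨1, fun i => by
    rw [abs_one, mul_one, one_mul]
    exact Real.rpow_le_rpow_of_exponent_le (by linarith [Nat.cast_nonneg (α := ℝ) i]) h⟩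

/-- The Gaussian white noise `N(0, I)` (independent standard normal coordinates), as a measure on
`X^s`: the restriction to `X^s ⊆ ℝ^ℕ` of the countable product of standard normal laws. -/
def whiteNoise (s : ℝ) : Measure (SobolevSeq s) :=
  (Measure.infinitePi fun _ : ℕ => gaussianReal 0 1).comap fun x => (x : ℕ → ℝ)

/-! ### The prior -/

variable {X : Type*} [NormedAddCommGroup X] [InnerProductSpace ℝ X] [CompleteSpace X]

/-- A prior covariance operator on `X` with an orthonormal basis of eigenvectors and polynomially
decaying eigenvalues: `C₁ i^(-κ) ≤ √λ_i ≤ C₂ i^(-κ)` for some `κ > 1/2`. -/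
structure PolyDecayPrior (X : Type*) [NormedAddCommGroup X] [InnerProductSpace ℝ X]
    [CompleteSpace X] where
  cov : X →L[ℝ] X
  basis : HilbertBasis ℕ ℝ X
  eig : ℕ → ℝ
  cov_basis : ∀ i, cov (basis i) = eig i • basis i
  κ : ℝ
  half_lt_κ : 1 / 2 < κ
  decay : ∃ C₁ C₂ : ℝ, 0 < C₁ ∧ 0 < C₂ ∧
    ∀ i : ℕ, C₁ * ((i : ℝ) + 1) ^ (-κ) ≤ √(eig i) ∧ √(eig i) ≤ C₂ * ((i : ℝ) + 1) ^ (-κ)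

namespace PolyDecayPrior

variable (P : PolyDecayPrior X)

/-- The identification of `X` with `X^0` through the coordinates in the eigenbasis. -/
def ofX : X →L[ℝ] SobolevSeq 0 :=
  LinearMap.mkContinuous
    { toFun := fun x => ⟨fun i => P.basis.repr x i, by
        have h := (memlp_iff 0 fun i => P.basis.repr x i).1 (by
          simpa [wt] using lp.memℓp (P.basis.repr x))
        exact h⟩
      map_add' := fun x y => Subtype.ext (funext fun i => by
        rw [map_add]; rfl)
      map_smul' := fun a x => Subtype.ext (funext fun i => by
        rw [map_smul]; rfl) }
    1
    (fun x => by
      rw [norm_eq, one_mul, ← P.basis.repr.norm_map x]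
      refine le_of_eq (congrArg _ ?_)
      ext i
      change wt 0 i * P.basis.repr x i = _
      simp [wt])

theorem ofX_apply (x : X) (i : ℕ) : P.ofX x i = ⟪P.basis i, x⟫ :=
  P.basis.repr_apply_apply x i

/-- The inverse identification of `X^0` with `X`: `x ↦ ∑ i, x_i e_i`. -/
def toX : SobolevSeq 0 →L[ℝ] X :=
  P.basis.repr.symm.toContinuousLinearEquiv.toContinuousLinearMap ∘L
    (toEll2 0).mkContinuous 1 (fun x => by rw [norm_eq, one_mul])

theorem inner_toX (x : SobolevSeq 0) (i : ℕ) : ⟪P.basis i, P.toX x⟫ = x i := by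
  rw [← P.basis.repr_apply_apply]
  change P.basis.repr (P.basis.repr.symm (toEll2 0 x)) i = x i
  rw [LinearIsometryEquiv.apply_symm_apply, toEll2_apply]
  simp [wt]

/-- The operator `C^{1/2}` (multiplication of the `i`-th coordinate by `√λ_i`) from `X^s` to `X^t`,
which is bounded when `t ≤ s + κ`. -/
def sqrtCov (s t : ℝ) (h : t ≤ s + P.κ) : SobolevSeq s →L[ℝ] SobolevSeq t :=
  diag s t (fun i => √(P.eig i)) (by
    obtain ⟨C₁, C₂, -, h2, hC⟩ := P.decay
    refine ⟨C₂, fun i => ?_⟩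
    have hi : (1 : ℝ) ≤ (i : ℝ) + 1 := by linarith [Nat.cast_nonneg (α := ℝ) i]
    rw [abs_of_nonneg (Real.sqrt_nonneg _)]
    calc wt t i * √(P.eig i) ≤ wt t i * (C₂ * ((i : ℝ) + 1) ^ (-P.κ)) :=
          mul_le_mul_of_nonneg_left (hC i).2 (wt_pos t i).le
      _ = C₂ * ((i : ℝ) + 1) ^ (t + -P.κ) := by
          rw [Real.rpow_add (by positivity)]; unfold wt; ring
      _ ≤ C₂ * wt s i :=
          mul_le_mul_of_nonneg_left
            (Real.rpow_le_rpow_of_exponent_le hi (by linarith)) h2.le)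

/-- The pairing `⟨x, w⟩ = ∑ j, ⟨e_j, x⟩ w_j` of `x ∈ X` with an element `w` of some `X^s`; it extends
the inner product of `X`. -/
def pair {s : ℝ} (x : X) (w : SobolevSeq s) : ℝ := ∑' j, ⟪P.basis j, x⟫ * w j

end PolyDecayPrior

/-! ### The inverse problem -/

/-- The data of the inverse problem: the regularity `ℓ ∈ [0, κ - 1/2)`, the forward map
`𝒢 : X^ℓ → ℝ^m`, the observation `y`, and the covariance matrix of the Gaussian noise. -/
structure InverseProblem (P : PolyDecayPrior X) (m : ℕ) where
  ℓ : ℝ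
  ℓ_nonneg : 0 ≤ ℓ
  ℓ_lt : ℓ < P.κ - 1 / 2
  forward : SobolevSeq ℓ → EuclideanSpace ℝ (Fin m)
  obs : EuclideanSpace ℝ (Fin m)
  noiseCov : Matrix (Fin m) (Fin m) ℝ

namespace InverseProblem

variable {P : PolyDecayPrior X} {m : ℕ} (S : InverseProblem P m)

/-- The space `X^(ℓ-κ)` of the whitened unknown `v = C^{-1/2} u`, where `u ∈ X^ℓ`. -/
abbrev White : Type := SobolevSeq (S.ℓ - P.κ)

/-- `v ↦ u = C^{1/2} v`, from `X^(ℓ-κ)` to `X^ℓ`. -/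
def unwhiten : S.White →L[ℝ] SobolevSeq S.ℓ :=
  P.sqrtCov (S.ℓ - P.κ) S.ℓ (by linarith)

/-- `v ↦ u = C^{1/2} v`, with `u` regarded as an element of `X`. -/
def unwhitenX : S.White →L[ℝ] X :=
  P.toX ∘L incl S.ℓ 0 S.ℓ_nonneg ∘L S.unwhiten

/-- `C^{1/2}` as a bounded operator from `X` to `X^ℓ`. -/
def sqrtCovX : X →L[ℝ] SobolevSeq S.ℓ :=
  P.sqrtCov 0 S.ℓ (by linarith [S.ℓ_lt]) ∘L P.ofX

/-- `X` as a subspace of `X^(ℓ-κ)`. -/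
def inclX : X →L[ℝ] S.White :=
  incl 0 (S.ℓ - P.κ) (by linarith [S.ℓ_lt]) ∘L P.ofX

/-- The law `N(0, I)` of the whitened unknown under the prior. -/
def prior : Measure S.White := whiteNoise (S.ℓ - P.κ)

/-- `Σ⁻¹` as an operator on `ℝ^m`. -/
def noisePrec : EuclideanSpace ℝ (Fin m) →L[ℝ] EuclideanSpace ℝ (Fin m) :=
  Matrix.toEuclideanCLM (𝕜 := ℝ) S.noiseCov⁻¹

/-- The potential `Φ(u) = ½ |y - 𝒢(u)|²_Σ`. -/
def potential (u : SobolevSeq S.ℓ) : ℝ :=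
  1 / 2 * ⟪S.obs - S.forward u, S.noisePrec (S.obs - S.forward u)⟫

/-- The potential in the whitened coordinates. -/
def Φ (v : S.White) : ℝ := S.potential (S.unwhiten v)

/-- `Z = ∫ exp(-Φ) dμ₀`. -/
def evidence : ℝ≥0∞ := ∫⁻ v, ENNReal.ofReal (Real.exp (-S.Φ v)) ∂S.prior

/-- The posterior law of the whitened unknown, `dμ/dμ₀ = exp(-Φ) / Z`. -/
def posterior : Measure S.White :=
  S.evidence⁻¹ • S.prior.withDensity fun v => ENNReal.ofReal (Real.exp (-S.Φ v))

/-- `∇_v Φ(v) = C^{1/2} ∇_u Φ(u)`: the element of `X` which represents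
`φ ↦ DΦ(u)[C^{1/2} φ]`, where `u = C^{1/2} v`. -/
def gradΦ (v : S.White) : X :=
  (InnerProductSpace.toDual ℝ X).symm (fderiv ℝ S.potential (S.unwhiten v) ∘L S.sqrtCovX)

/-- `∇𝒢(u) C^{1/2} : X → ℝ^m`, where `u = C^{1/2} v`. -/
def jac (v : S.White) : X →L[ℝ] EuclideanSpace ℝ (Fin m) :=
  fderiv ℝ S.forward (S.unwhiten v) ∘L S.sqrtCovX

/-- The prior-preconditioned Gauss-Newton Hessian
`ℋ(v) = C^{1/2} ∇𝒢(u)^* Σ⁻¹ ∇𝒢(u) C^{1/2}`, where `u = C^{1/2} v`. -/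
def hess (v : S.White) : X →L[ℝ] X :=
  ContinuousLinearMap.adjoint (S.jac v) ∘L S.noisePrec ∘L S.jac v

/-- At every `v`, the vectors `V v 0, …, V v (r-1)` of `X` are orthonormal eigenvectors of `ℋ(v)`, and
`Λ v 0 ≥ … ≥ Λ v (r-1)` are the corresponding eigenvalues, which are the `r` largest ones. -/
structure IsLeadingEigenpairs (r : ℕ) (Λ : S.White → Fin r → ℝ) (V : S.White → Fin r → X) :
    Prop where
  orthonormal : ∀ v, Orthonormal ℝ (V v)
  eigen : ∀ v i, S.hess v (V v i) = Λ v i • V v i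
  antitone : ∀ v, Antitone (Λ v)
  leading : ∀ v (φ : X) (t : ℝ), φ ≠ 0 → (∀ j, ⟪V v j, φ⟫ = 0) → S.hess v φ = t • φ →
    ∀ i, t ≤ Λ v i

/-! ### Operators built from `r` eigenpairs `(Λ i, V i)` at one point -/

variable {r : ℕ}

/-- `V_r f(Λ_r) V_r^* x` for `x ∈ X`. -/
def lowRank (Λ : Fin r → ℝ) (V : Fin r → X) (f : ℝ → ℝ) (x : X) : X :=
  ∑ i, (f (Λ i) * ⟪V i, x⟫) • V i

/-- `V_r f(Λ_r) V_r^* w ∈ X` for `w ∈ X^(ℓ-κ)`. -/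
def lowRankW (Λ : Fin r → ℝ) (V : Fin r → X) (f : ℝ → ℝ) (w : S.White) : X :=
  ∑ i, (f (Λ i) * P.pair (V i) w) • V i

/-- `D_r = (I_r + Λ_r)⁻¹`, entrywise. -/
def D (t : ℝ) : ℝ := (1 + t)⁻¹

/-- `K̂ = (I + V_r Λ_r V_r^*)⁻¹ = I + V_r (D_r - I_r) V_r^*` on `X`. -/
def Khat (Λ : Fin r → ℝ) (V : Fin r → X) (x : X) : X :=
  x + lowRank Λ V (fun t => D t - 1) x

/-- `K̂^{1/2} = I + V_r (√D_r - I_r) V_r^*` on `X^(ℓ-κ)`. -/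
def KhatSqrtW (Λ : Fin r → ℝ) (V : Fin r → X) (w : S.White) : S.White :=
  w + S.inclX (S.lowRankW Λ V (fun t => √(D t) - 1) w)

/-- `K̂^{-1/2} = I + V_r (D_r^{-1/2} - I_r) V_r^*` on `X`. -/
def KhatInvSqrt (Λ : Fin r → ℝ) (V : Fin r → X) (x : X) : X :=
  x + lowRank Λ V (fun t => (√(D t))⁻¹ - 1) x

/-- `K̂^{-1/2} = I + V_r (D_r^{-1/2} - I_r) V_r^*` on `X^(ℓ-κ)`. -/
def KhatInvSqrtW (Λ : Fin r → ℝ) (V : Fin r → X) (w : S.White) : S.White :=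
  w + S.inclX (S.lowRankW Λ V (fun t => (√(D t))⁻¹ - 1) w)

/-- The determinant `|K̂^{-1/2}|`. The operator `K̂^{-1/2}` is the identity on the orthogonal
complement of the span of the `V i` and acts as `D_r^{-1/2}` on this span. -/
def detKhatInvSqrt (Λ : Fin r → ℝ) : ℝ :=
  (Matrix.diagonal fun i => (√(D (Λ i)))⁻¹).det

/-- `s(γ) = γ_r V_r V_r^* + γ_⊥ V_⊥ V_⊥^*`, with `V_⊥ V_⊥^* = I - V_r V_r^*`. -/
def sγ (γr γp : ℝ) (Λ : Fin r → ℝ) (V : Fin r → X) (x : X) : X :=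
  γr • lowRank Λ V (fun _ => 1) x + γp • (x - lowRank Λ V (fun _ => 1) x)

end InverseProblem

/-! ### The step-size parameters -/

/-- `ρ₀ = (1 - h/4) / (1 + h/4)`. -/
def ρ₀ (h : ℝ) : ℝ := (1 - h / 4) / (1 + h / 4)

/-- `ρ₁ = 1 - ρ₀`. -/
def ρ₁ (h : ℝ) : ℝ := 1 - ρ₀ h

/-- `ρ₂ = √(1 - ρ₀²)`. -/
def ρ₂ (h : ℝ) : ℝ := √(1 - ρ₀ h ^ 2)

namespace InverseProblem

variable {P : PolyDecayPrior X} {m r : ℕ} (S : InverseProblem P m)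

/-- The proposal at the position `v` with the noise `ξ`:
`v' = (ρ₀ I - ρ₁ V_r (D_r - I_r) V_r^*) v - ρ₁ (I + V_r (D_r - I_r) V_r^*) s(γ) ∇_v Φ(v)
  + ρ₂ (I + V_r (√D_r - I_r) V_r^*) ξ`. -/
def proposal (Λ : S.White → Fin r → ℝ) (V : S.White → Fin r → X) (h γr γp : ℝ)
    (v ξ : S.White) : S.White :=
  (ρ₀ h • v - ρ₁ h • S.inclX (S.lowRankW (Λ v) (V v) (fun t => D t - 1) v))
    - ρ₁ h • S.inclX (Khat (Λ v) (V v) (sγ γr γp (Λ v) (V v) (S.gradΦ v)))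
    + ρ₂ h • S.KhatSqrtW (Λ v) (V v) ξ

/-- `ĝ(v) = -K̂(v) { -Ĥ(v) v + s(γ) ∇_v Φ(v) }`, with `Ĥ = V_r Λ_r V_r^*`. -/
def ghat (Λ : S.White → Fin r → ℝ) (V : S.White → Fin r → X) (γr γp : ℝ) (v : S.White) : X :=
  -Khat (Λ v) (V v)
    (-S.lowRankW (Λ v) (V v) (fun t => t) v + sγ γr γp (Λ v) (V v) (S.gradΦ v))

/-- The density `λ(w; v)` of the acceptance ratio:
`exp{-(h/8) |K̂^{-1/2} ĝ|² + (√h/2) ⟨K̂^{-1/2} ĝ, K̂^{-1/2} w⟩} exp{-½ ⟨w, Ĥ w⟩} |K̂^{-1/2}|`,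
with `ĝ`, `K̂`, `Ĥ` taken at `v`. -/
def lam (Λ : S.White → Fin r → ℝ) (V : S.White → Fin r → X) (h γr γp : ℝ)
    (w v : S.White) : ℝ :=
  Real.exp (-(h / 8) * ‖KhatInvSqrt (Λ v) (V v) (S.ghat Λ V γr γp v)‖ ^ 2
      + √h / 2 * P.pair (KhatInvSqrt (Λ v) (V v) (S.ghat Λ V γr γp v))
          (S.KhatInvSqrtW (Λ v) (V v) w))
    * Real.exp (-(1 / 2) * P.pair (S.lowRankW (Λ v) (V v) (fun t => t) w) w)
    * detKhatInvSqrt (Λ v)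

/-- `w^* = (v' - ρ₀ v) / ρ₂`. -/
def wstar (h : ℝ) (v v' : S.White) : S.White := (ρ₂ h)⁻¹ • (v' - ρ₀ h • v)

/-- `κ(v, v') = exp{-Φ(v)} λ(w^*; v)`. -/
def kap (Λ : S.White → Fin r → ℝ) (V : S.White → Fin r → X) (h γr γp : ℝ)
    (v v' : S.White) : ℝ :=
  Real.exp (-S.Φ v) * S.lam Λ V h γr γp (S.wstar h v v') v

/-- The acceptance probability `a(v, v') = 1 ∧ κ(v', v) / κ(v, v')`. -/
def accept (Λ : S.White → Fin r → ℝ) (V : S.White → Fin r → X) (h γr γp : ℝ)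
    (v v' : S.White) : ℝ :=
  min 1 (S.kap Λ V h γr γp v' v / S.kap Λ V h γr γp v v')

/-- The law `ν(dv, dv') = μ(dv) Q(v, dv')` of the position and the proposal. -/
def joint (Q : Kernel S.White S.White) : Measure (S.White × S.White) := S.posterior ⊗ₘ Q

/-- The law `ν` in the original coordinates `u = C^{1/2} v`, as a measure on `X × X`. -/
def jointX [MeasurableSpace X] (Q : Kernel S.White S.White) : Measure (X × X) :=
  (S.joint Q).map (Prod.map S.unwhitenX S.unwhitenX)

end InverseProblem

end DRMala

end

/-! The proposal is compared with the preconditioned Crank-Nicolson move `v' = ρ₀ v + ρ₂ w`, where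
`v` and `w` are independent white noises. Its joint law η is symmetric because `ρ₀² + ρ₂² = 1`: a
reflection of the pair `(v, w)`, which preserves the product of white noises, exchanges `v` and `v'`
(`map_swap_referenceJoint`).

The identities `ρ₂ √h / 2 = ρ₁` and `K̂ Ĥ = I - K̂` turn the proposal into `ρ₀ v + ρ₂ (K̂^{1/2} ξ +
(√h/2) ĝ)` (`proposal_eq`). For fixed `v` the bracket is white noise, shifted by a Cameron-Martin
vector and then rescaled along finitely many orthonormal directions. Its law therefore has the
explicit density `λ(·; v)` with respect to `N(0, I)` (`hasDensity_KhatSqrtW`). Integrating over the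
posterior gives `ν = Z⁻¹ κ η` (`joint_eq_withDensity`). Since η is symmetric and κ is strictly
positive, the transpose of ν has density `κ(v', v) / κ(v, v')` with respect to ν, which yields both
the equivalence and the acceptance probability.

The analytic difficulty is that `v` lies outside `X`, so `⟨x, v⟩` makes sense at every `v` only if
`x` defines a continuous functional on `X^(ℓ-κ)`, that is, if `x` is in `dualRange`. The gradient is
in it because `DΦ(u) C^{1/2}` extends from `X` to `X^(ℓ-κ)`. An eigenvector with nonzero eigenvalue
is in it because `λ_i v_i = ℋ v_i` factors through `∇𝒢(u) C^{1/2}`. An eigenvector with zero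
eigenvalue may fail to be in it, but contributes nothing: the functions of `Λ_r` paired with
`X^(ℓ-κ)` vanish at zero, and in `s(γ) ∇Φ` its coefficient vanishes because it is in the kernel of
the Jacobian.

The Gaussian facts follow from the characteristic functional `exp(-‖x‖²/2)` alone, which determines
a finite measure on a separable Banach space. The splitting `IsWhite.map_splitting` reduces a change
of one coordinate to the normal law on the line. -/

noncomputable section

namespace DRMala

/-! ### White noise on a Banach space -/

section White

variable {H W : Type*} [NormedAddCommGroup H] [InnerProductSpace ℝ H]
  [NormedAddCommGroup W] [NormedSpace ℝ W]

/-- The functional `L` on `W` restricts to `⟪x, ·⟫` along `J : H → W`. -/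
def Represents (J : H →L[ℝ] W) (L : StrongDual ℝ W) (x : H) : Prop :=
  ∀ z, L (J z) = ⟪x, z⟫

theorem Represents.add {J : H →L[ℝ] W} {L M : StrongDual ℝ W} {x y : H}
    (hL : Represents J L x) (hM : Represents J M y) : Represents J (L + M) (x + y) := by
  intro z
  rw [inner_add_left, ← hL z, ← hM z]; rfl

theorem Represents.smul {J : H →L[ℝ] W} {L : StrongDual ℝ W} {x : H} (c : ℝ)
    (hL : Represents J L x) : Represents J (c • L) (c • x) := by
  intro z
  rw [real_inner_smul_left, ← hL z]; rfl

theorem Represents.neg {J : H →L[ℝ] W} {L : StrongDual ℝ W} {x : H}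
    (hL : Represents J L x) : Represents J (-L) (-x) := by
  intro z
  rw [inner_neg_left, ← hL z]; rfl

theorem Represents.sub {J : H →L[ℝ] W} {L M : StrongDual ℝ W} {x y : H}
    (hL : Represents J L x) (hM : Represents J M y) : Represents J (L - M) (x - y) := by
  simpa [sub_eq_add_neg] using hL.add hM.neg

theorem Represents.zero (J : H →L[ℝ] W) : Represents J 0 0 := fun z => by simp

/-- By the Riesz theorem, `L ∘ J` is the inner product with some vector. The converse fails in
general, which is why `dualRange` is needed later. -/
theorem exists_represents [CompleteSpace H] (J : H →L[ℝ] W) (L : StrongDual ℝ W) :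
    ∃ x, Represents J L x :=
  ⟨(InnerProductSpace.toDual ℝ H).symm (L ∘L J), fun z => by simp⟩

variable [MeasurableSpace W]

/-- The centred Gaussian measure on `W` with Cameron-Martin space `H`, by its Fourier transform. -/
def IsWhite (J : H →L[ℝ] W) (μ : Measure W) : Prop :=
  ∀ (L : StrongDual ℝ W) (x : H), Represents J L x →
    charFunDual μ L = Complex.exp (-(‖x‖ ^ 2 / 2 : ℝ))

variable [CompleteSpace H] [BorelSpace W] [SecondCountableTopology W] [CompleteSpace W]
  {J : H →L[ℝ] W} {μ : Measure W} [IsProbabilityMeasure μ]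

theorem charFunDual_gaussianReal (L : StrongDual ℝ ℝ) :
    charFunDual (gaussianReal 0 1) L = Complex.exp (-((L 1) ^ 2 / 2 : ℝ)) := by
  have h : ∀ x, L x = L 1 * x := fun x => by
    have := L.map_smul x 1
    rwa [smul_eq_mul, smul_eq_mul, mul_one, mul_comm] at this
  have := charFun_gaussianReal (μ := 0) (v := 1) (L 1)
  rw [charFun_apply_real] at this
  rw [charFunDual_apply]
  generalize L 1 = t at h this ⊢
  simp_rw [h]
  push_cast
  rw [this]
  congr 1
  simp

/-- The coordinate along a unit vector may be resampled independently of the rest. A functional with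
representer `x` sees `⟪x, f⟫` on the line and `x - ⟪x, f⟫ f` on the remainder, and Pythagoras adds
up the squared norms. -/
theorem IsWhite.map_splitting (hμ : IsWhite J μ) {φ : StrongDual ℝ W} {f : H}
    (hφ : Represents J φ f) (hf : ‖f‖ = 1) :
    ((gaussianReal 0 1).prod μ).map (fun p : ℝ × W => p.1 • J f + (p.2 - φ p.2 • J f)) = μ := by
  let M : ℝ × W →L[ℝ] W :=
    (ContinuousLinearMap.fst ℝ ℝ W).smulRight (J f) +
      (ContinuousLinearMap.snd ℝ ℝ W - (φ ∘L ContinuousLinearMap.snd ℝ ℝ W).smulRight (J f))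
  have hM : (fun p : ℝ × W => p.1 • J f + (p.2 - φ p.2 • J f)) = M := rfl
  rw [hM]
  have : IsProbabilityMeasure (((gaussianReal 0 1).prod μ).map M) :=
    Measure.isProbabilityMeasure_map M.continuous.measurable.aemeasurable
  refine Measure.ext_of_charFunDual (funext fun L => ?_)
  obtain ⟨x, hx⟩ := exists_represents J L
  rw [charFunDual_map, charFunDual_prod, charFunDual_gaussianReal, hμ L x hx,
    hμ _ (x - ⟪x, f⟫ • f), ← Complex.exp_add]
  · congr 1
    have h1 : ((L ∘L M) ∘L ContinuousLinearMap.inl ℝ ℝ W) 1 = ⟪x, f⟫ := by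
      simp [M, hx f]
    rw [h1]
    norm_cast
    rw [norm_sub_sq_real, norm_smul, real_inner_smul_right, hf, Real.norm_eq_abs, mul_one, sq_abs]
    ring
  · intro z
    have h1 : ((L ∘L M) ∘L ContinuousLinearMap.inr ℝ ℝ W) (J z)
        = L (J z) - φ (J z) * L (J f) := by
      simp [M]
    rw [h1, hx, hx, hφ, inner_sub_left, real_inner_smul_left]
    ring

/-- With `x` and `y` representing the two halves of a functional, `‖ax + by‖² + ‖bx - ay‖² = (a² +
b²)(‖x‖² + ‖y‖²)`. The reflection, rather than the rotation, is the orthogonal map that later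
exchanges position and proposal. -/
theorem IsWhite.map_reflection (hμ : IsWhite J μ) {a b : ℝ} (hab : a ^ 2 + b ^ 2 = 1) :
    (μ.prod μ).map (fun p : W × W => (a • p.1 + b • p.2, b • p.1 - a • p.2)) = μ.prod μ := by
  let M : W × W →L[ℝ] W × W :=
    (a • ContinuousLinearMap.fst ℝ W W + b • ContinuousLinearMap.snd ℝ W W).prod
      (b • ContinuousLinearMap.fst ℝ W W - a • ContinuousLinearMap.snd ℝ W W)
  have hM : (fun p : W × W => (a • p.1 + b • p.2, b • p.1 - a • p.2)) = M := rfl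
  rw [hM]
  have : IsProbabilityMeasure ((μ.prod μ).map M) :=
    Measure.isProbabilityMeasure_map M.continuous.measurable.aemeasurable
  refine Measure.ext_of_charFunDual (funext fun L => ?_)
  obtain ⟨x, hx⟩ := exists_represents J (L ∘L ContinuousLinearMap.inl ℝ W W)
  obtain ⟨y, hy⟩ := exists_represents J (L ∘L ContinuousLinearMap.inr ℝ W W)
  have h1 : (L ∘L M) ∘L ContinuousLinearMap.inl ℝ W W =
      a • (L ∘L ContinuousLinearMap.inl ℝ W W) + b • (L ∘L ContinuousLinearMap.inr ℝ W W) := by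
    ext w
    have : (a • w, b • w) = a • (w, (0 : W)) + b • ((0 : W), w) := by simp
    simp [M, this, map_add, map_smul, -Prod.smul_mk, -Prod.mk_add_mk]
  have h2 : (L ∘L M) ∘L ContinuousLinearMap.inr ℝ W W =
      b • (L ∘L ContinuousLinearMap.inl ℝ W W) - a • (L ∘L ContinuousLinearMap.inr ℝ W W) := by
    ext w
    have : (b • w, -(a • w)) = b • (w, (0 : W)) - a • ((0 : W), w) := by simp
    simp [M, this, map_sub, map_smul, -Prod.smul_mk, -Prod.mk_sub_mk]
  rw [charFunDual_map, charFunDual_prod, charFunDual_prod, h1, h2, hμ _ _ hx, hμ _ _ hy,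
    hμ _ _ ((hx.smul a).add (hy.smul b)), hμ _ _ ((hx.smul b).sub (hy.smul a)),
    ← Complex.exp_add, ← Complex.exp_add]
  congr 1
  norm_cast
  rw [norm_sub_sq_real, norm_add_sq_real]
  simp only [norm_smul, real_inner_smul_right, real_inner_smul_left, Real.norm_eq_abs, mul_pow,
    sq_abs]
  linear_combination (-(‖x‖ ^ 2 + ‖y‖ ^ 2) / 2) * hab

/-! ### Densities of transformed Gaussian laws -/

/-- The law of `T` under `μ` has density `ρ` with respect to `μ`. -/
def HasDensity {Ω : Type*} [MeasurableSpace Ω] (μ : Measure Ω) (T : Ω → Ω) (ρ : Ω → ℝ≥0∞) : Prop :=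
  ∀ g : Ω → ℝ≥0∞, Measurable g → ∫⁻ w, g (T w) ∂μ = ∫⁻ w, g w * ρ w ∂μ

/-- Once the inner density is written as a function of `T₁ w`, it can be absorbed into the test
function before `T₁` is changed; no inverse of `T₁` is required. -/
theorem HasDensity.comp {Ω : Type*} [MeasurableSpace Ω] {μ : Measure Ω} {T₁ T₂ : Ω → Ω}
    {ρ₁ ρ₂ ρ₃ : Ω → ℝ≥0∞} (h₁ : HasDensity μ T₁ ρ₁) (h₂ : HasDensity μ T₂ ρ₂)
    (hT₁ : Measurable T₁) (hρ : ∀ w, ρ₂ w = ρ₃ (T₁ w)) (hρ₃ : Measurable ρ₃) :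
    HasDensity μ (fun w => T₁ (T₂ w)) (fun w => ρ₃ w * ρ₁ w) := by
  intro g hg
  rw [h₂ (fun w => g (T₁ w)) (hg.comp hT₁)]
  simp_rw [hρ]
  rw [h₁ (fun w => g w * ρ₃ w) (hg.mul hρ₃)]
  simp_rw [mul_assoc]

theorem hasDensity_id {Ω : Type*} [MeasurableSpace Ω] (μ : Measure Ω) :
    HasDensity μ (fun w => w) (fun _ => 1) := fun g _ => by simp

theorem lintegral_gaussianReal (b : ℝ) {v : ℝ≥0} (hv : v ≠ 0) {g : ℝ → ℝ≥0∞} (hg : Measurable g) :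
    ∫⁻ x, g x ∂gaussianReal b v = ∫⁻ x, g x * gaussianPDF b v x := by
  rw [gaussianReal_of_var_ne_zero b hv, lintegral_withDensity_eq_lintegral_mul _
    (measurable_gaussianPDF b v) hg]
  simp_rw [Pi.mul_apply, mul_comm]

theorem hasDensity_gaussianReal_shift (b : ℝ) :
    HasDensity (gaussianReal 0 1) (fun x => x + b)
      (fun x => ENNReal.ofReal (Real.exp (b * x - b ^ 2 / 2))) := by
  intro g hg
  beta_reduce
  rw [← lintegral_map (f := g) (g := fun x => x + b) hg (by fun_prop),
    gaussianReal_map_add_const, lintegral_gaussianReal _ one_ne_zero hg,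
    lintegral_gaussianReal _ one_ne_zero (by fun_prop)]
  refine lintegral_congr fun x => ?_
  rw [mul_assoc, gaussianPDF, gaussianPDF, ← ENNReal.ofReal_mul (Real.exp_nonneg _),
    gaussianPDFReal, gaussianPDFReal]
  congr 2
  rw [mul_left_comm, ← Real.exp_add]
  congr 2
  simp
  ring

theorem hasDensity_gaussianReal_scale {c : ℝ} (hc : 0 < c) :
    HasDensity (gaussianReal 0 1) (fun x => c * x)
      (fun x => ENNReal.ofReal (c⁻¹ * Real.exp (-(1 / 2) * ((c⁻¹ ^ 2 - 1) * x ^ 2)))) := by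
  intro g hg
  have hv : (NNReal.mk (c ^ 2) (sq_nonneg c) * 1 : ℝ≥0) ≠ 0 := by
    rw [mul_one]
    exact fun h => (pow_pos hc 2).ne' (congrArg NNReal.toReal h)
  beta_reduce
  rw [← lintegral_map (f := g) (g := fun x => c * x) hg (by fun_prop),
    gaussianReal_map_const_mul, mul_zero, lintegral_gaussianReal _ hv hg,
    lintegral_gaussianReal _ one_ne_zero (by fun_prop)]
  refine lintegral_congr fun x => ?_
  rw [mul_assoc, gaussianPDF, gaussianPDF, ← ENNReal.ofReal_mul (by positivity),
    gaussianPDFReal, gaussianPDFReal]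
  congr 2
  simp only [NNReal.coe_mk, NNReal.coe_one, mul_one, sub_zero]
  rw [Real.sqrt_mul (by positivity), Real.sqrt_sq hc.le, mul_inv, mul_mul_mul_comm,
    ← Real.exp_add, mul_comm c⁻¹]
  congr 2
  field_simp
  ring

/-- A transformation of the coordinate along a unit vector `f`. -/
theorem IsWhite.hasDensity_line (hμ : IsWhite J μ) {φ : StrongDual ℝ W} {f : H}
    (hφ : Represents J φ f) (hf : ‖f‖ = 1) {A : ℝ → ℝ} {ρ : ℝ → ℝ≥0∞} (hA : Measurable A)
    (hρ : Measurable ρ) (h : HasDensity (gaussianReal 0 1) A ρ) :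
    HasDensity μ (fun w => w + (A (φ w) - φ w) • J f) (fun w => ρ (φ w)) := by
  intro g hg
  have hM : Measurable fun p : ℝ × W => p.1 • J f + (p.2 - φ p.2 • J f) := by fun_prop
  -- Since `φ (J f) = ‖f‖² = 1`, the coordinate of the reassembled vector is the real variable
  -- itself, so the claim reduces to the line for each fixed remainder.
  have hφM : ∀ p : ℝ × W, φ (p.1 • J f + (p.2 - φ p.2 • J f)) = p.1 := fun p => by
    simp [hφ f, hf]
  have hAW : Measurable fun w => w + (A (φ w) - φ w) • J f := by fun_prop
  have hρW : Measurable fun w => g w * ρ (φ w) := by fun_prop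
  conv_lhs => rw [← hμ.map_splitting hφ hf]
  conv_rhs => rw [← hμ.map_splitting hφ hf]
  have hgA : Measurable fun w => g (w + (A (φ w) - φ w) • J f) := hg.comp hAW
  beta_reduce
  rw [lintegral_map hgA hM, lintegral_map hρW hM]
  simp_rw [hφM]
  rw [lintegral_prod_symm _ (by fun_prop), lintegral_prod_symm _ (by fun_prop)]
  refine lintegral_congr fun w => ?_
  rw [← h (fun x => g (x • J f + (w - φ w • J f))) (by fun_prop)]
  refine lintegral_congr fun x => ?_
  congr 1
  simp only [sub_smul]
  abel

/-- The Cameron-Martin formula, from the shift by `‖x‖` of the coordinate along `x / ‖x‖`. -/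
theorem IsWhite.hasDensity_shift (hμ : IsWhite J μ) {φ : StrongDual ℝ W} {x : H}
    (hφ : Represents J φ x) :
    HasDensity μ (fun w => w + J x)
      (fun w => ENNReal.ofReal (Real.exp (φ w - ‖x‖ ^ 2 / 2))) := by
  by_cases hx : x = 0
  -- A functional represented by zero need not vanish identically, as `J` is not assumed to have
  -- dense range; it vanishes almost everywhere, because its law is the Dirac mass at zero.
  · subst hx
    have hae : ∀ᵐ w ∂μ, φ w = 0 := by
      have h1 : μ.map φ = Measure.dirac 0 := by
        have : IsProbabilityMeasure (μ.map φ) :=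
          Measure.isProbabilityMeasure_map φ.continuous.measurable.aemeasurable
        refine Measure.ext_of_charFunDual (funext fun L => ?_)
        have h2 : Represents J (L ∘L φ) 0 := fun z => by simp [hφ z]
        rw [charFunDual_map, hμ _ _ h2, charFunDual_dirac]
        simp
      have h3 : ∀ᵐ t ∂(μ.map φ), t = 0 := by
        rw [h1]
        exact (ae_dirac_iff (measurableSet_singleton 0)).2 rfl
      exact ae_of_ae_map φ.continuous.measurable.aemeasurable h3
    intro g _
    refine lintegral_congr_ae ?_
    filter_upwards [hae] with w hw
    simp [hw]
  · have hx' : ‖x‖ ≠ 0 := norm_ne_zero_iff.2 hx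
    have h := hμ.hasDensity_line (hφ.smul ‖x‖⁻¹) (by rw [norm_smul]; simp [hx'])
      (A := fun t => t + ‖x‖) (by fun_prop) (by fun_prop) (hasDensity_gaussianReal_shift ‖x‖)
    convert h using 2 with w w
    · rw [map_smul, smul_smul]
      simp [hx']
    · congr 3
      simp [hx']

/-- Scaling of the coordinates along finitely many orthonormal vectors. -/
theorem IsWhite.hasDensity_scale (hμ : IsWhite J μ) {ι : Type*} {V : ι → H}
    (hV : Orthonormal ℝ V) (φ : ι → StrongDual ℝ W) (c : ι → ℝ) (hc : ∀ i, 0 < c i)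
    (hφ : ∀ i, c i = 1 ∨ Represents J (φ i) (V i)) (s : Finset ι) :
    HasDensity μ (fun w => w + ∑ i ∈ s, ((c i - 1) * φ i w) • J (V i))
      (fun w => ∏ i ∈ s, ENNReal.ofReal
        ((c i)⁻¹ * Real.exp (-(1 / 2) * (((c i)⁻¹ ^ 2 - 1) * φ i w ^ 2)))) := by
  classical
  induction s using Finset.induction_on with
  | empty => simpa using hasDensity_id μ
  | insert i s his ih =>
    have hi : HasDensity μ (fun w => w + ((c i - 1) * φ i w) • J (V i))
        (fun w => ENNReal.ofReal
          ((c i)⁻¹ * Real.exp (-(1 / 2) * (((c i)⁻¹ ^ 2 - 1) * φ i w ^ 2)))) := by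
      rcases hφ i with h | h
      · simpa [h] using hasDensity_id μ
      · convert hμ.hasDensity_line h (hV.1 i) (A := fun t => c i * t) (by fun_prop) (by fun_prop)
          (hasDensity_gaussianReal_scale (hc i)) using 4
        ring
    -- By orthonormality, scaling one coordinate leaves the others unchanged, so the densities
    -- multiply. A coordinate with `c j = 1` is not moved, and its functional is arbitrary.
    have hz : ∀ i j, i ≠ j → c j ≠ 1 → φ j (J (V i)) = 0 := fun i j hij hj => by
      rw [(hφ j).resolve_left hj, hV.2 hij.symm]
    convert hi.comp ih (by fun_prop) (ρ₃ := fun w => ∏ i ∈ s, ENNReal.ofReal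
        ((c i)⁻¹ * Real.exp (-(1 / 2) * (((c i)⁻¹ ^ 2 - 1) * φ i w ^ 2)))) ?_ ?_ using 1
    · funext w
      rw [Finset.sum_insert his, add_assoc, add_comm (∑ i ∈ s, _)]
      by_cases h : c i = 1
      · simp [h]
      · have : φ i (∑ j ∈ s, ((c j - 1) * φ j w) • J (V j)) = 0 := by
          rw [map_sum]
          refine Finset.sum_eq_zero fun j hj => ?_
          rw [map_smul, hz j i (fun e => his (e ▸ hj)) h, smul_zero]
        rw [map_add, this, add_zero]
    · funext w
      rw [Finset.prod_insert his, mul_comm]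
    · intro w
      refine Finset.prod_congr rfl fun j hj => ?_
      by_cases h : c j = 1
      · simp [h]
      · rw [map_add, map_smul, hz i j (fun e => his (e ▸ hj)) h, smul_zero, add_zero]
    · fun_prop

end White

/-! ### The sequence spaces as separable Banach spaces -/

section Sequences

variable (s : ℝ)

theorem toEll2_surjective : Function.Surjective (toEll2 s) := by
  intro y
  have hy : (fun i => wt s i * ((wt s i)⁻¹ * y i)) = fun i => y i :=
    funext fun i => mul_inv_cancel_left₀ (wt_pos s i).ne' _
  refine ⟨⟨fun i => (wt s i)⁻¹ * y i, (memlp_iff s _).1 ?_⟩, ?_⟩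
  · rw [hy]
    exact lp.memℓp y
  · ext i
    exact congrFun hy i

/-- The isometry of `X^s` with `ℓ²`. -/
def ell2Equiv : SobolevSeq s ≃ₗᵢ[ℝ] lp (fun _ : ℕ => ℝ) 2 where
  toLinearEquiv := LinearEquiv.ofBijective (toEll2 s) ⟨toEll2_injective s, toEll2_surjective s⟩
  norm_map' _ := rfl

instance : CompleteSpace (SobolevSeq s) :=
  (ell2Equiv s).toIsometryEquiv.completeSpace

/-- The sequence whose only nonzero entry is a one at `j`. -/
def unitSeq (j : ℕ) : SobolevSeq s :=
  ⟨Pi.single j 1, by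
    refine summable_of_ne_finset_zero (s := {j}) fun i hi => ?_
    rw [Finset.mem_singleton] at hi
    simp [Pi.single_eq_of_ne hi]⟩

theorem unitSeq_apply (i j : ℕ) : unitSeq s j i = (Pi.single j 1 : ℕ → ℝ) i := rfl

theorem smul_apply (c : ℝ) (w : SobolevSeq s) (i : ℕ) : (c • w) i = c * w i := rfl

theorem hasSum_unitSeq (w : SobolevSeq s) : HasSum (fun j => w j • unitSeq s j) w := by
  have h := (lp.hasSum_single (E := fun _ : ℕ => ℝ) (p := 2) (by norm_num) (toEll2 s w)).mapL
    (ell2Equiv s).symm.toContinuousLinearEquiv.toContinuousLinearMap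
  have h2 : ∀ y, (ell2Equiv s).symm.toContinuousLinearEquiv.toContinuousLinearMap (toEll2 s y) = y :=
    fun y => (ell2Equiv s).symm_apply_apply y
  rw [h2] at h
  convert h using 2 with j
  rw [← h2 (w j • unitSeq s j)]
  congr 1
  ext i
  rw [toEll2_apply, smul_apply, unitSeq_apply, lp.single_apply]
  by_cases hij : i = j
  · subst hij
    simp [toEll2_apply]
  · simp [Pi.single_eq_of_ne hij]

theorem hasSum_dual (L : StrongDual ℝ (SobolevSeq s)) (w : SobolevSeq s) :
    HasSum (fun j => L (unitSeq s j) * w j) (L w) := by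
  refine ((hasSum_unitSeq s w).mapL L).congr_fun fun j => ?_
  rw [map_smul, smul_eq_mul, mul_comm]

instance : SecondCountableTopology (SobolevSeq s) := by
  have h : TopologicalSpace.IsSeparable
      (closure (Submodule.span ℝ (range (unitSeq s)) : Set (SobolevSeq s))) :=
    ((countable_range _).isSeparable.span (R := ℝ)).closure
  have hu : closure (Submodule.span ℝ (range (unitSeq s)) : Set (SobolevSeq s)) = univ := by
    refine eq_univ_of_forall fun w => ?_
    refine mem_closure_of_tendsto (hasSum_unitSeq s w) (Filter.Eventually.of_forall fun t => ?_)
    exact Submodule.sum_mem _ fun j _ =>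
      Submodule.smul_mem _ _ (Submodule.subset_span (mem_range_self j))
  rw [hu] at h
  have := TopologicalSpace.isSeparable_univ_iff.1 h
  exact UniformSpace.secondCountable_of_separable _

/-- The `i`-th coordinate as a functional on `X^s`. -/
def coordDual (i : ℕ) : StrongDual ℝ (SobolevSeq s) :=
  LinearMap.mkContinuous
    { toFun := fun w => w i
      map_add' := fun _ _ => rfl
      map_smul' := fun _ _ => rfl } (wt s i)⁻¹ (fun w => by
        have h := lp.norm_apply_le_norm (p := 2) (by norm_num) (toEll2 s w) i
        rw [toEll2_apply, norm_mul, Real.norm_of_nonneg (wt_pos s i).le, ← norm_eq] at h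
        rwa [inv_mul_eq_div, le_div_iff₀' (wt_pos s i)])

theorem continuous_apply (i : ℕ) : Continuous fun w : SobolevSeq s => w i :=
  (coordDual s i).continuous

/-- An injective continuous map from a Polish space is a measurable embedding. This makes the
`comap` in `whiteNoise` the actual restriction of the product measure and not its default value
zero. -/
theorem measurableEmbedding_coe :
    MeasurableEmbedding (fun w : SobolevSeq s => (w : ℕ → ℝ)) :=
  (continuous_pi fun i => continuous_apply s i).measurableEmbedding Subtype.val_injective

end Sequences

/-! ### White noise on the sequence spaces -/

section WhiteNoise

variable {s : ℝ}

/-- The expectation of `∑ i^(2s) x_i²` is `∑ i^(2s)` times the second moment of a standard normal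
variable, finite since `2s < -1`; so the series converges almost surely. -/
theorem ae_mem_sobolev (hs : s < -(1 / 2)) :
    ∀ᵐ x ∂(Measure.infinitePi fun _ : ℕ => gaussianReal 0 1),
      Summable fun i : ℕ => ((i : ℝ) + 1) ^ (2 * s) * x i ^ 2 := by
  have hsum : Summable fun i : ℕ => ((i : ℝ) + 1) ^ (2 * s) := by
    have h := (summable_nat_add_iff 1).2 (Real.summable_nat_rpow (p := 2 * s).2 (by linarith))
    simpa using h
  have h2 : ∫⁻ x, ENNReal.ofReal (x ^ 2) ∂gaussianReal 0 1 ≠ ⊤ :=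
    ((memLp_id_gaussianReal (μ := 0) (v := 1) 2).integrable_sq.lintegral_lt_top).ne
  have hint : ∫⁻ x : ℕ → ℝ, ∑' i : ℕ, ENNReal.ofReal (((i : ℝ) + 1) ^ (2 * s) * x i ^ 2)
      ∂(Measure.infinitePi fun _ : ℕ => gaussianReal 0 1) ≠ ⊤ := by
    rw [lintegral_tsum fun i => Measurable.aemeasurable (by fun_prop)]
    have h3 : ∀ i : ℕ, ∫⁻ x : ℕ → ℝ, ENNReal.ofReal (((i : ℝ) + 1) ^ (2 * s) * x i ^ 2)
        ∂(Measure.infinitePi fun _ : ℕ => gaussianReal 0 1)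
        = ENNReal.ofReal (((i : ℝ) + 1) ^ (2 * s)) *
          ∫⁻ x, ENNReal.ofReal (x ^ 2) ∂gaussianReal 0 1 := by
      intro i
      rw [← (measurePreserving_eval_infinitePi (fun _ : ℕ => gaussianReal 0 1) i).lintegral_comp
        (by fun_prop), ← lintegral_const_mul _ (by fun_prop)]
      refine lintegral_congr fun x => ?_
      rw [ENNReal.ofReal_mul (by positivity)]
    simp_rw [h3]
    rw [ENNReal.tsum_mul_right]
    exact ENNReal.mul_ne_top hsum.tsum_ofReal_ne_top h2
  filter_upwards [ae_lt_top (by fun_prop) hint] with x hx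
  have := ENNReal.summable_toReal hx.ne
  refine this.congr fun i => ?_
  rw [ENNReal.toReal_ofReal (by positivity)]

theorem map_whiteNoise (hs : s < -(1 / 2)) :
    (whiteNoise s).map (fun w : SobolevSeq s => (w : ℕ → ℝ)) =
      Measure.infinitePi fun _ : ℕ => gaussianReal 0 1 := by
  unfold whiteNoise
  rw [(measurableEmbedding_coe s).map_comap, Measure.restrict_eq_self_of_ae_mem]
  filter_upwards [ae_mem_sobolev hs] with x hx
  exact ⟨⟨x, hx⟩, rfl⟩

theorem isProbabilityMeasure_whiteNoise (hs : s < -(1 / 2)) :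
    IsProbabilityMeasure (whiteNoise s) := by
  have h : IsProbabilityMeasure ((whiteNoise s).map (fun w : SobolevSeq s => (w : ℕ → ℝ))) := by
    rw [map_whiteNoise hs]
    infer_instance
  constructor
  have h1 := h.measure_univ
  rwa [(measurableEmbedding_coe s).map_apply, preimage_univ] at h1

theorem integral_exp_whiteNoise (hs : s < -(1 / 2)) (a : ℕ → ℝ) (t : Finset ℕ) :
    ∫ w, Complex.exp (((∑ j ∈ t, a j * w j : ℝ) : ℂ) * Complex.I) ∂(whiteNoise s) =
      Complex.exp (-(∑ j ∈ t, a j ^ 2 / 2 : ℝ)) := by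
  have hm : Measurable fun x : ℕ → ℝ => ∑ j ∈ t, a j * x j := by fun_prop
  have h1 : ∫ w, Complex.exp (((∑ j ∈ t, a j * w j : ℝ) : ℂ) * Complex.I) ∂(whiteNoise s) =
      ∫ x : ℕ → ℝ, Complex.exp (((∑ j ∈ t, a j * x j : ℝ) : ℂ) * Complex.I)
        ∂(Measure.infinitePi fun _ : ℕ => gaussianReal 0 1) := by
    rw [← map_whiteNoise hs, (measurableEmbedding_coe s).integral_map]
  have hind := iIndepFun_infinitePi (P := fun _ : ℕ => gaussianReal 0 1)
    (X := fun j x => a j * x) (fun j => by fun_prop)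
  have h2 := congrFun (iIndepFun.charFun_map_fun_finsetSum_eq_prod (s := t)
    (X := fun j (x : ℕ → ℝ) => a j * x j) (fun i _ => Measurable.aemeasurable (by fun_prop)) (hind.restrict t)) 1
  rw [charFun_apply_real, integral_map hm.aemeasurable (by fun_prop)] at h2
  simp only [Complex.ofReal_one, one_mul, Finset.prod_apply] at h2
  rw [h1, h2, Complex.ofReal_sum, ← Finset.sum_neg_distrib, Complex.exp_sum]
  refine Finset.prod_congr rfl fun j _ => ?_
  have h3 : (Measure.infinitePi fun _ : ℕ => gaussianReal 0 1).map (fun x => a j * x j) =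
      (gaussianReal 0 1).map (fun x => a j * x) := by
    conv_rhs => rw [← Measure.infinitePi_map_eval (fun _ : ℕ => gaussianReal 0 1) j,
      Measure.map_map (by fun_prop) (by fun_prop)]
    rfl
  rw [h3, charFun_map_mul, charFun_gaussianReal]
  congr 1
  simp

end WhiteNoise

/-! ### The prior as white noise, and the law of `u` -/

namespace InverseProblem

variable {X : Type*} [NormedAddCommGroup X] [InnerProductSpace ℝ X] [CompleteSpace X]
  {P : PolyDecayPrior X} {m : ℕ} (S : InverseProblem P m)

theorem exponent_lt : S.ℓ - P.κ < -(1 / 2) := by linarith [S.ℓ_lt]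

theorem inclX_apply (x : X) (i : ℕ) : S.inclX x i = ⟪P.basis i, x⟫ := by
  change 1 * P.ofX x i = _
  rw [one_mul, P.ofX_apply]

theorem inclX_basis (j : ℕ) : S.inclX (P.basis j) = unitSeq _ j := by
  refine Subtype.ext (funext fun i => ?_)
  change S.inclX (P.basis j) i = (Pi.single j 1 : ℕ → ℝ) i
  rw [inclX_apply, orthonormal_iff_ite.1 P.basis.orthonormal, Pi.single_apply]

instance isProbabilityMeasure_prior : IsProbabilityMeasure S.prior :=
  isProbabilityMeasure_whiteNoise S.exponent_lt

/-- A continuous functional is the pointwise limit of its coordinate partial sums, whose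
characteristic functions are finite products. Dominated convergence on one side and Parseval on the
other give the limit. -/
theorem isWhite_prior : IsWhite S.inclX S.prior := by
  intro L x hx
  have ha : ∀ j, L (unitSeq _ j) = ⟪P.basis j, x⟫ := fun j => by
    rw [← S.inclX_basis, hx, real_inner_comm]
  have hsq : HasSum (fun j => ⟪P.basis j, x⟫ ^ 2 / 2) (‖x‖ ^ 2 / 2) := by
    have h := (P.basis.hasSum_inner_mul_inner x x).div_const 2
    rw [real_inner_self_eq_norm_sq] at h
    refine h.congr_fun fun j => ?_
    rw [real_inner_comm x, sq]
  have h1 : Filter.Tendsto (fun n => ∫ w, Complex.exp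
      (((∑ j ∈ Finset.range n, ⟪P.basis j, x⟫ * w j : ℝ) : ℂ) * Complex.I) ∂S.prior)
      Filter.atTop (nhds (charFunDual S.prior L)) := by
    rw [charFunDual_apply]
    refine tendsto_integral_of_dominated_convergence (fun _ => 1) (fun n => ?_)
      (integrable_const _) (fun n => Filter.Eventually.of_forall fun w => ?_)
      (Filter.Eventually.of_forall fun w => ?_)
    · refine Continuous.aestronglyMeasurable ?_
      have h := continuous_apply (S.ℓ - P.κ)
      have h' : Continuous fun w : S.White => ∑ j ∈ Finset.range n, ⟪P.basis j, x⟫ * w j :=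
        continuous_finsetSum _ fun j _ => (h j).const_mul _
      exact Complex.continuous_exp.comp ((Complex.continuous_ofReal.comp h').mul_const _)
    · rw [Complex.norm_exp_ofReal_mul_I]
    · have h := (hasSum_dual _ L w).tendsto_sum_nat
      simp_rw [ha] at h
      exact (Complex.continuous_exp.tendsto _).comp
        (((Complex.continuous_ofReal.tendsto _).comp h).mul_const _)
  refine tendsto_nhds_unique h1 ?_
  simp_rw [prior, integral_exp_whiteNoise S.exponent_lt]
  exact (Complex.continuous_exp.tendsto _).comp
    ((Complex.continuous_ofReal.tendsto _).comp hsq.tendsto_sum_nat).neg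

theorem eig_pos (P : PolyDecayPrior X) (i : ℕ) : 0 < P.eig i := by
  obtain ⟨C₁, C₂, h1, -, hC⟩ := P.decay
  have := (hC i).1
  have h2 : 0 < √(P.eig i) := lt_of_lt_of_le (by positivity) this
  exact Real.sqrt_pos.1 h2

theorem inner_unwhitenX (v : S.White) (i : ℕ) :
    ⟪P.basis i, S.unwhitenX v⟫ = √(P.eig i) * v i := by
  change ⟪P.basis i, P.toX (incl S.ℓ 0 S.ℓ_nonneg (S.unwhiten v))⟫ = _
  rw [P.inner_toX]
  change 1 * (√(P.eig i) * v i) = _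
  rw [one_mul]

/-- The representer is `C^{1/2} t`: its coordinates are `√λ_j ⟨e_j, t⟩`. -/
theorem norm_sq_of_represents {t x : X}
    (hx : Represents S.inclX (innerSL ℝ t ∘L S.unwhitenX) x) : ‖x‖ ^ 2 = ⟪t, P.cov t⟫ := by
  have hxj : ∀ j, ⟪P.basis j, x⟫ = √(P.eig j) * ⟪P.basis j, t⟫ := by
    intro j
    have h1 : S.unwhitenX (S.inclX (P.basis j)) = √(P.eig j) • P.basis j := by
      apply P.basis.repr.injective
      ext i
      rw [P.basis.repr_apply_apply, P.basis.repr_apply_apply, inner_unwhitenX, inclX_basis,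
        unitSeq_apply, real_inner_smul_right, orthonormal_iff_ite.1 P.basis.orthonormal,
        Pi.single_apply]
      split_ifs with h
      · rw [h]
      · simp
    rw [real_inner_comm, ← hx]
    simp [h1, real_inner_comm t]
  have h1 := P.basis.hasSum_inner_mul_inner x x
  have h2 : HasSum (fun j => ⟪P.basis j, x⟫ * ⟪x, P.basis j⟫) ⟪t, P.cov t⟫ := by
    have h3 := (P.basis.hasSum_repr t).mapL (innerSL ℝ t ∘L P.cov)
    refine h3.congr_fun fun j => ?_
    rw [real_inner_comm (P.basis j) x, hxj]
    simp only [ContinuousLinearMap.comp_apply, innerSL_apply_apply, map_smul, P.cov_basis,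
      P.basis.repr_apply_apply, smul_eq_mul]
    rw [real_inner_comm (P.basis j) t]
    have := Real.mul_self_sqrt (eig_pos P j).le
    linear_combination (⟪P.basis j, t⟫ * ⟪P.basis j, t⟫) * this
  rw [← real_inner_self_eq_norm_sq]
  refine HasSum.unique ?_ h2
  refine h1.congr_fun fun j => mul_comm _ _

theorem charFun_map_unwhitenX [MeasurableSpace X] [BorelSpace X] (t : X) :
    charFun (S.prior.map S.unwhitenX) t = Complex.exp (-(inner ℝ t (P.cov t) / 2 : ℝ)) := by
  obtain ⟨x, hx⟩ := exists_represents S.inclX (innerSL ℝ t ∘L S.unwhitenX)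
  rw [charFun_eq_charFunDual_toDualMap, charFunDual_map]
  refine (S.isWhite_prior _ x hx).trans ?_
  rw [S.norm_sq_of_represents hx]

end InverseProblem

/-! ### The operators built from finitely many eigenpairs -/

/-- The elements of `H` which define a continuous functional on `W`. -/
def dualRange {H W : Type*} [NormedAddCommGroup H] [InnerProductSpace ℝ H]
    [NormedAddCommGroup W] [NormedSpace ℝ W] (J : H →L[ℝ] W) : Submodule ℝ H where
  carrier := {x | ∃ φ, Represents J φ x}
  zero_mem' := ⟨0, Represents.zero J⟩
  add_mem' := fun ⟨φ, h⟩ ⟨ψ, h'⟩ => ⟨φ + ψ, h.add h'⟩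
  smul_mem' := fun c _ ⟨φ, h⟩ => ⟨c • φ, h.smul c⟩

namespace InverseProblem

section LowRank

variable {X : Type*} [NormedAddCommGroup X] [InnerProductSpace ℝ X] {r : ℕ} {Λ : Fin r → ℝ}
  {V : Fin r → X}

theorem inner_sum_orthonormal (hV : Orthonormal ℝ V) (a : Fin r → ℝ) (i : Fin r) :
    ⟪V i, ∑ j, a j • V j⟫ = a i :=
  hV.inner_right_fintype a i

/-- Orthonormality makes `f ↦ V_r f(Λ_r) V_r^*` multiplicative, so the operator identities below
reduce to scalar identities in each eigenvalue. -/
theorem lowRank_lowRank (hV : Orthonormal ℝ V) (f g : ℝ → ℝ) (x : X) :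
    lowRank Λ V f (lowRank Λ V g x) = lowRank Λ V (fun t => f t * g t) x := by
  unfold lowRank
  refine Finset.sum_congr rfl fun i _ => ?_
  rw [inner_sum_orthonormal hV, mul_assoc]

theorem lowRank_add (f : ℝ → ℝ) (x y : X) :
    lowRank Λ V f (x + y) = lowRank Λ V f x + lowRank Λ V f y := by
  simp only [lowRank, inner_add_right, mul_add, add_smul, Finset.sum_add_distrib]

theorem lowRank_smul (f : ℝ → ℝ) (c : ℝ) (x : X) :
    lowRank Λ V f (c • x) = c • lowRank Λ V f x := by
  simp only [lowRank, real_inner_smul_right, Finset.smul_sum, smul_smul]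
  exact Finset.sum_congr rfl fun i _ => by rw [mul_left_comm]

theorem Khat_add (x y : X) : Khat Λ V (x + y) = Khat Λ V x + Khat Λ V y := by
  unfold Khat
  rw [lowRank_add]
  abel

theorem Khat_smul (c : ℝ) (x : X) : Khat Λ V (c • x) = c • Khat Λ V x := by
  unfold Khat
  rw [lowRank_smul, smul_add]

end LowRank

variable {X : Type*} [NormedAddCommGroup X] [InnerProductSpace ℝ X] [CompleteSpace X]
  {P : PolyDecayPrior X} {m : ℕ} (S : InverseProblem P m)

theorem hasSum_pair {φ : StrongDual ℝ S.White} {x : X} (hφ : Represents S.inclX φ x)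
    (w : S.White) : HasSum (fun j => ⟪P.basis j, x⟫ * w j) (φ w) := by
  refine (hasSum_dual _ φ w).congr_fun fun j => ?_
  rw [← S.inclX_basis, hφ, real_inner_comm]

theorem pair_eq {φ : StrongDual ℝ S.White} {x : X} (hφ : Represents S.inclX φ x)
    (w : S.White) : P.pair x w = φ w :=
  (S.hasSum_pair hφ w).tsum_eq

variable {r : ℕ} {Λ : Fin r → ℝ} {V : Fin r → X}

theorem lowRank_lowRankW (hV : Orthonormal ℝ V) (f g : ℝ → ℝ) (w : S.White) :
    lowRank Λ V f (S.lowRankW Λ V g w) = S.lowRankW Λ V (fun t => f t * g t) w := by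
  unfold lowRank lowRankW
  refine Finset.sum_congr rfl fun i _ => ?_
  rw [inner_sum_orthonormal hV, mul_assoc]

theorem lowRank_mem_dualRange (f : ℝ → ℝ) {x : X}
    (h : ∀ i, f (Λ i) * ⟪V i, x⟫ = 0 ∨ V i ∈ dualRange S.inclX) :
    lowRank Λ V f x ∈ dualRange S.inclX := by
  refine Submodule.sum_mem _ fun i _ => ?_
  rcases h i with h | h
  · rw [h, zero_smul]
    exact Submodule.zero_mem _
  · exact Submodule.smul_mem _ _ h

theorem lowRankW_mem_dualRange (f : ℝ → ℝ) {w : S.White}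
    (h : ∀ i, f (Λ i) = 0 ∨ V i ∈ dualRange S.inclX) :
    S.lowRankW Λ V f w ∈ dualRange S.inclX := by
  refine Submodule.sum_mem _ fun i _ => ?_
  rcases h i with h | h
  · rw [h, zero_mul, zero_smul]
    exact Submodule.zero_mem _
  · exact Submodule.smul_mem _ _ h

theorem D_zero : D 0 = 1 := by simp [D]

theorem sqrt_D_pos {t : ℝ} (ht : 0 ≤ t) : 0 < √(D t) := by
  unfold D
  positivity

theorem inv_sqrt_D_sq {t : ℝ} (ht : 0 ≤ t) : (√(D t))⁻¹ ^ 2 = 1 + t := by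
  rw [inv_pow, Real.sq_sqrt (by unfold D; positivity), D, inv_inv]

section Eigenpairs

variable {S} {φ : Fin r → StrongDual ℝ S.White}

/-- The condition `f 0 = 0` discards the directions whose pairing may diverge, so whatever value
`tsum` takes there is multiplied by zero. -/
theorem lowRankW_eq (hφ : ∀ i, Λ i = 0 ∨ Represents S.inclX (φ i) (V i)) {f : ℝ → ℝ}
    (hf : f 0 = 0) (w : S.White) :
    S.lowRankW Λ V f w = ∑ i, (f (Λ i) * φ i w) • V i := by
  refine Finset.sum_congr rfl fun i _ => ?_
  rcases hφ i with h | h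
  · rw [h, hf, zero_mul, zero_mul]
  · rw [S.pair_eq h]

theorem lowRankW_add_inclX (hφ : ∀ i, Λ i = 0 ∨ Represents S.inclX (φ i) (V i)) {f : ℝ → ℝ}
    (hf : f 0 = 0) (w : S.White) (x : X) :
    S.lowRankW Λ V f (w + S.inclX x) = S.lowRankW Λ V f w + lowRank Λ V f x := by
  rw [lowRankW_eq hφ hf, lowRankW_eq hφ hf, lowRank, ← Finset.sum_add_distrib]
  refine Finset.sum_congr rfl fun i _ => ?_
  rcases hφ i with h | h
  · simp [h, hf]
  · rw [map_add, h x, mul_add, add_smul]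

/-- Moves the shift inside `K̂^{1/2}`, so that the Cameron-Martin formula applies to white noise
before the rescaling. -/
theorem KhatSqrtW_add_inclX (hΛ : ∀ i, 0 ≤ Λ i) (hV : Orthonormal ℝ V)
    (hφ : ∀ i, Λ i = 0 ∨ Represents S.inclX (φ i) (V i)) (w : S.White) (g : X) :
    S.KhatSqrtW Λ V (w + S.inclX (KhatInvSqrt Λ V g)) = S.KhatSqrtW Λ V w + S.inclX g := by
  have h : KhatInvSqrt Λ V g + lowRank Λ V (fun t => √(D t) - 1) (KhatInvSqrt Λ V g) = g := by
    unfold KhatInvSqrt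
    rw [lowRank_add, lowRank_lowRank hV, add_assoc, add_eq_left]
    unfold lowRank
    rw [← Finset.sum_add_distrib, ← Finset.sum_add_distrib]
    refine Finset.sum_eq_zero fun i _ => ?_
    rw [← add_smul, ← add_smul]
    have := mul_inv_cancel₀ (sqrt_D_pos (hΛ i)).ne'
    convert zero_smul ℝ (V i)
    linear_combination ⟪V i, g⟫ * this
  unfold KhatSqrtW
  rw [lowRankW_add_inclX hφ (by simp [D_zero])]
  conv_rhs => rw [← h]
  simp only [map_add]
  abel

theorem KhatInvSqrtW_KhatSqrtW (hΛ : ∀ i, 0 ≤ Λ i) (hV : Orthonormal ℝ V)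
    (hφ : ∀ i, Λ i = 0 ∨ Represents S.inclX (φ i) (V i)) (w : S.White) :
    S.KhatInvSqrtW Λ V (S.KhatSqrtW Λ V w) = w := by
  unfold KhatInvSqrtW KhatSqrtW
  rw [lowRankW_add_inclX hφ (by simp [D_zero]), lowRank_lowRankW S hV, add_assoc, ← map_add,
    add_eq_left]
  convert map_zero S.inclX
  unfold lowRankW
  rw [← Finset.sum_add_distrib, ← Finset.sum_add_distrib]
  refine Finset.sum_eq_zero fun i _ => ?_
  rw [← add_smul, ← add_smul]
  have := mul_inv_cancel₀ (sqrt_D_pos (hΛ i)).ne'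
  convert zero_smul ℝ (V i)
  linear_combination P.pair (V i) w * this

theorem KhatInvSqrtW_eq (hφ : ∀ i, Λ i = 0 ∨ Represents S.inclX (φ i) (V i)) (w : S.White) :
    S.KhatInvSqrtW Λ V w =
      w + ∑ i, (((√(D (Λ i)))⁻¹ - 1) * φ i w) • S.inclX (V i) := by
  unfold KhatInvSqrtW
  rw [lowRankW_eq hφ (by simp [D_zero]), map_sum]
  simp_rw [map_smul]

theorem KhatSqrtW_eq (hφ : ∀ i, Λ i = 0 ∨ Represents S.inclX (φ i) (V i)) (w : S.White) :
    S.KhatSqrtW Λ V w = w + ∑ i, ((√(D (Λ i)) - 1) * φ i w) • S.inclX (V i) := by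
  unfold KhatSqrtW
  rw [lowRankW_eq hφ (by simp [D_zero]), map_sum]
  simp_rw [map_smul]

theorem pair_lowRankW (hφ : ∀ i, Λ i = 0 ∨ Represents S.inclX (φ i) (V i)) (w : S.White) :
    P.pair (S.lowRankW Λ V (fun t => t) w) w = ∑ i, Λ i * φ i w ^ 2 := by
  -- The coefficients `φ i w` are frozen to obtain a linear functional, which is then evaluated at
  -- the same `w`.
  have h : Represents S.inclX (∑ i, (Λ i * φ i w) • φ i) (S.lowRankW Λ V (fun t => t) w) := by
    intro z
    rw [lowRankW_eq hφ rfl, sum_inner, sum_apply]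
    refine Finset.sum_congr rfl fun i _ => ?_
    rcases hφ i with h | h
    · simp [h]
    · rw [real_inner_smul_left, ← h z]; rfl
  rw [S.pair_eq h, sum_apply]
  refine Finset.sum_congr rfl fun i _ => ?_
  change Λ i * φ i w * φ i w = _
  ring

/-- The density of the law of `K̂^{1/2} ξ + (√h/2) g`. -/
theorem hasDensity_KhatSqrtW (hΛ : ∀ i, 0 ≤ Λ i) (hV : Orthonormal ℝ V)
    (hφ : ∀ i, Λ i = 0 ∨ Represents S.inclX (φ i) (V i)) {h : ℝ} (hh : 0 < h) {g : X}
    (hg : KhatInvSqrt Λ V g ∈ dualRange S.inclX) :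
    HasDensity S.prior (fun ξ => S.KhatSqrtW Λ V ξ + (√h / 2) • S.inclX g)
      (fun w => ENNReal.ofReal (Real.exp (-(h / 8) * ‖KhatInvSqrt Λ V g‖ ^ 2
          + √h / 2 * P.pair (KhatInvSqrt Λ V g) (S.KhatInvSqrtW Λ V w))
        * Real.exp (-(1 / 2) * P.pair (S.lowRankW Λ V (fun t => t) w) w)
        * detKhatInvSqrt Λ)) := by
  obtain ⟨ψ, hψ⟩ := hg
  have h1 := S.isWhite_prior.hasDensity_scale hV φ (fun i => √(D (Λ i)))
    (fun i => sqrt_D_pos (hΛ i))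
    (fun i => (hφ i).imp (fun h0 => by simp [h0, D_zero]) id) Finset.univ
  have h2 := S.isWhite_prior.hasDensity_shift (hψ.smul (√h / 2))
  have hK : Measurable (S.KhatSqrtW Λ V) := by
    rw [funext (KhatSqrtW_eq hφ)]
    fun_prop
  have hKi : Measurable (S.KhatInvSqrtW Λ V) := by
    rw [funext (KhatInvSqrtW_eq hφ)]
    fun_prop
  simp_rw [← KhatSqrtW_eq hφ] at h1
  -- Shift first, then scale: the shift density becomes a function of the scaled variable through
  -- `K̂^{-1/2} K̂^{1/2} = I`.
  convert h1.comp h2 hK (ρ₃ := fun w => ENNReal.ofReal (Real.exp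
    (((√h / 2) • ψ) (S.KhatInvSqrtW Λ V w) - ‖(√h / 2) • KhatInvSqrt Λ V g‖ ^ 2 / 2)))
    (fun w => by rw [KhatInvSqrtW_KhatSqrtW hΛ hV hφ]) (by fun_prop) using 1
  · funext ξ
    rw [map_smul]
    have := KhatSqrtW_add_inclX hΛ hV hφ ξ ((√h / 2) • g)
    rw [map_smul] at this
    rw [← this]
    congr 2
    unfold KhatInvSqrt
    rw [lowRank_smul, ← smul_add, map_smul]
  · funext w
    rw [← ENNReal.ofReal_prod_of_nonneg (fun i _ => by positivity), ← ENNReal.ofReal_mul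
      (Real.exp_nonneg _), mul_assoc]
    congr 2
    · rw [S.pair_eq hψ, norm_smul, mul_pow, Real.norm_eq_abs, sq_abs, div_pow,
        Real.sq_sqrt hh.le]
      change _ = Real.exp (√h / 2 * ψ (S.KhatInvSqrtW Λ V w) - _)
      congr 1
      ring
    · rw [pair_lowRankW hφ, detKhatInvSqrt, Matrix.det_diagonal, Finset.mul_sum, Real.exp_sum,
        ← Finset.prod_mul_distrib]
      refine Finset.prod_congr rfl fun i _ => ?_
      rw [inv_sqrt_D_sq (hΛ i), mul_comm, add_sub_cancel_left]

end Eigenpairs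

/-! ### Step-size identities and the form of the proposal -/

theorem ρ₂_sq {h : ℝ} (hh : 0 < h) : 1 - ρ₀ h ^ 2 = (√h / (1 + h / 4)) ^ 2 := by
  unfold ρ₀
  rw [div_pow (√h), Real.sq_sqrt hh.le]
  field_simp
  ring

theorem ρ₂_eq {h : ℝ} (hh : 0 < h) : ρ₂ h = √h / (1 + h / 4) := by
  unfold ρ₂
  rw [ρ₂_sq hh, Real.sqrt_sq (by positivity)]

theorem ρ₂_pos {h : ℝ} (hh : 0 < h) : 0 < ρ₂ h := by
  rw [ρ₂_eq hh]
  positivity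

theorem ρ₀_sq_add_ρ₂_sq {h : ℝ} (hh : 0 < h) : ρ₀ h ^ 2 + ρ₂ h ^ 2 = 1 := by
  rw [ρ₂_eq hh, ← ρ₂_sq hh]
  ring

/-- Explains the factor `√h / 2` in the acceptance ratio: it is `ρ₁ / ρ₂`. -/
theorem ρ₂_mul {h : ℝ} (hh : 0 < h) : ρ₂ h * (√h / 2) = ρ₁ h := by
  have h1 : √h * √h = h := Real.mul_self_sqrt hh.le
  rw [ρ₂_eq hh, ρ₁, ρ₀]
  field_simp
  linear_combination 4 * h1

/-- From `(1 + λ) D(λ) = 1` one gets `K̂ Ĥ v = -V_r (D_r - I_r) V_r^* v`, so `ĝ` collects the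
low-rank drift in `v` together with the gradient drift. -/
theorem proposal_eq {Λ : S.White → Fin r → ℝ} {V : S.White → Fin r → X} {h : ℝ} (hh : 0 < h)
    (γr γp : ℝ) {v : S.White} (hΛ : ∀ i, 0 ≤ Λ v i) (hV : Orthonormal ℝ (V v)) (ξ : S.White) :
    S.proposal Λ V h γr γp v ξ = ρ₀ h • v + ρ₂ h •
      (S.KhatSqrtW (Λ v) (V v) ξ + (√h / 2) • S.inclX (S.ghat Λ V γr γp v)) := by
  have h1 : Khat (Λ v) (V v) (S.lowRankW (Λ v) (V v) (fun t => t) v) =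
      -S.lowRankW (Λ v) (V v) (fun t => D t - 1) v := by
    unfold Khat
    rw [lowRank_lowRankW S hV, ← add_eq_zero_iff_eq_neg]
    unfold lowRankW
    rw [← Finset.sum_add_distrib, ← Finset.sum_add_distrib]
    refine Finset.sum_eq_zero fun i _ => ?_
    rw [← add_smul, ← add_smul]
    convert zero_smul ℝ (V v i)
    have : (1 + Λ v i) * D (Λ v i) = 1 := mul_inv_cancel₀ (by linarith [hΛ i])
    linear_combination P.pair (V v i) v * this
  have h2 : S.ghat Λ V γr γp v = -S.lowRankW (Λ v) (V v) (fun t => D t - 1) v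
      - Khat (Λ v) (V v) (sγ γr γp (Λ v) (V v) (S.gradΦ v)) := by
    unfold ghat
    rw [Khat_add, ← neg_one_smul ℝ (S.lowRankW (Λ v) (V v) (fun t => t) v), Khat_smul, h1]
    module
  rw [proposal, smul_add, smul_smul, ρ₂_mul hh, h2, map_sub, map_neg]
  module

end InverseProblem

namespace InverseProblem

variable {X : Type*} [NormedAddCommGroup X] [InnerProductSpace ℝ X] [CompleteSpace X]
  {P : PolyDecayPrior X} {m : ℕ} {S : InverseProblem P m}

/-! ### The gradient and the Gauss-Newton Hessian -/

theorem unwhiten_inclX (z : X) : S.unwhiten (S.inclX z) = S.sqrtCovX z := by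
  refine Subtype.ext (funext fun i => ?_)
  change √(P.eig i) * (1 * P.ofX z i) = √(P.eig i) * P.ofX z i
  rw [one_mul]

theorem differentiable_forward (hG : ∀ k, Differentiable ℝ fun u => S.forward u k) :
    Differentiable ℝ S.forward :=
  differentiable_euclidean.2 hG

theorem inner_noisePrec_nonneg (hS : S.noiseCov.PosDef) (x : EuclideanSpace ℝ (Fin m)) :
    0 ≤ ⟪x, S.noisePrec x⟫ := by
  rw [noisePrec, Matrix.inner_toEuclideanCLM]
  exact hS.inv.posSemidef.dotProduct_mulVec_nonneg x.ofLp

theorem eq_zero_of_inner_noisePrec (hS : S.noiseCov.PosDef) {x : EuclideanSpace ℝ (Fin m)}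
    (hx : ⟪x, S.noisePrec x⟫ = 0) : x = 0 := by
  rw [noisePrec, Matrix.inner_toEuclideanCLM] at hx
  by_contra h
  have h' : x.ofLp ≠ 0 := fun e => h (WithLp.ofLp_injective 2 e)
  exact (hS.inv.dotProduct_mulVec_pos h').ne' hx

theorem Φ_nonneg (hS : S.noiseCov.PosDef) (v : S.White) : 0 ≤ S.Φ v :=
  mul_nonneg (by norm_num) (inner_noisePrec_nonneg hS _)

theorem inner_gradΦ (v : S.White) (z : X) :
    ⟪S.gradΦ v, z⟫ = fderiv ℝ S.potential (S.unwhiten v) (S.sqrtCovX z) := by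
  simp [gradΦ]

/-- `unwhiten` extends `C^{1/2}` from `X` to the whole of `X^(ℓ-κ)`, so the derivative composed with
it is the required functional. -/
theorem gradΦ_mem (v : S.White) : S.gradΦ v ∈ dualRange S.inclX :=
  ⟨fderiv ℝ S.potential (S.unwhiten v) ∘L S.unwhiten, fun z => by
    rw [inner_gradΦ, ← unwhiten_inclX]; rfl⟩

theorem hess_inner (v : S.White) (x z : X) :
    ⟪S.hess v x, z⟫ = ⟪S.noisePrec (S.jac v x), S.jac v z⟫ := by
  simp [hess, ContinuousLinearMap.adjoint_inner_left]

/-- By the product rule, each term of the derivative of the quadratic misfit contains the derivative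
of `𝒢` in the given direction. -/
theorem inner_gradΦ_eq_zero (hG : ∀ k, Differentiable ℝ fun u => S.forward u k) {v : S.White}
    {z : X} (hz : S.jac v z = 0) : ⟪S.gradΦ v, z⟫ = 0 := by
  have h1 := ((differentiable_forward hG) (S.unwhiten v)).hasFDerivAt.const_sub S.obs
  have h2 := (h1.inner ℝ (S.noisePrec.hasFDerivAt.comp _ h1)).const_mul (1 / 2)
  have h3 : HasFDerivAt S.potential _ (S.unwhiten v) := h2
  have hz' : fderiv ℝ S.forward (S.unwhiten v) (S.sqrtCovX z) = 0 := hz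
  rw [inner_gradΦ, h3.fderiv]
  simp [hz']

variable {r : ℕ} {Λ : S.White → Fin r → ℝ} {V : S.White → Fin r → X}

namespace IsLeadingEigenpairs

/-- The Rayleigh quotient. It gives nonnegativity, measurability of the eigenvalues, and, for a zero
eigenvalue, that the Jacobian annihilates the eigenvector. -/
theorem eigenvalue_eq (hΛV : S.IsLeadingEigenpairs r Λ V) (v : S.White) (i : Fin r) :
    Λ v i = ⟪S.jac v (V v i), S.noisePrec (S.jac v (V v i))⟫ := by
  rw [real_inner_comm, ← hess_inner, hΛV.eigen, real_inner_smul_left, real_inner_self_eq_norm_sq,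
    (hΛV.orthonormal v).1 i]
  simp

theorem eigenvalue_nonneg (hΛV : S.IsLeadingEigenpairs r Λ V) (hS : S.noiseCov.PosDef)
    (v : S.White) (i : Fin r) : 0 ≤ Λ v i := by
  rw [hΛV.eigenvalue_eq]
  exact inner_noisePrec_nonneg hS _

/-- `λ_i v_i = ℋ v_i` is represented by a functional that factors through `∇𝒢(u)` and `unwhiten`; it
remains to divide by `λ_i`. -/
theorem mem_dualRange (hΛV : S.IsLeadingEigenpairs r Λ V) {v : S.White} {i : Fin r}
    (hi : Λ v i ≠ 0) : V v i ∈ dualRange S.inclX := by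
  have h : Λ v i • V v i ∈ dualRange S.inclX :=
    ⟨innerSL ℝ (S.noisePrec (S.jac v (V v i))) ∘L fderiv ℝ S.forward (S.unwhiten v) ∘L S.unwhiten,
      fun z => by
        rw [← hΛV.eigen, hess_inner, jac]
        simp [unwhiten_inclX]⟩
  simpa [smul_smul, hi] using Submodule.smul_mem _ (Λ v i)⁻¹ h

theorem exists_represents (hΛV : S.IsLeadingEigenpairs r Λ V) (v : S.White) :
    ∃ φ : Fin r → StrongDual ℝ S.White, ∀ i, Λ v i = 0 ∨ Represents S.inclX (φ i) (V v i) := by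
  have h : ∀ i, ∃ φ : StrongDual ℝ S.White, Λ v i = 0 ∨ Represents S.inclX φ (V v i) := by
    intro i
    by_cases hi : Λ v i = 0
    · exact ⟨0, Or.inl hi⟩
    · obtain ⟨φ, hφ⟩ := hΛV.mem_dualRange hi
      exact ⟨φ, Or.inr hφ⟩
  choose φ hφ using h
  exact ⟨φ, hφ⟩

theorem lowRank_mem (hΛV : S.IsLeadingEigenpairs r Λ V) {f : ℝ → ℝ} (hf : f 0 = 0)
    (v : S.White) (x : X) : lowRank (Λ v) (V v) f x ∈ dualRange S.inclX :=
  S.lowRank_mem_dualRange f fun i => by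
    by_cases hi : Λ v i = 0
    · left; rw [hi, hf, zero_mul]
    · exact Or.inr (hΛV.mem_dualRange hi)

theorem lowRankW_mem (hΛV : S.IsLeadingEigenpairs r Λ V) {f : ℝ → ℝ} (hf : f 0 = 0)
    (v w : S.White) : S.lowRankW (Λ v) (V v) f w ∈ dualRange S.inclX :=
  S.lowRankW_mem_dualRange f fun i => by
    by_cases hi : Λ v i = 0
    · left; rw [hi, hf]
    · exact Or.inr (hΛV.mem_dualRange hi)

/-- Here the spectral function is constantly one and does not vanish at zero; the coefficient `⟨v_i,
∇Φ⟩` does so instead, since `v_i` is then in the kernel of the Jacobian. -/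
theorem sγ_mem (hΛV : S.IsLeadingEigenpairs r Λ V) (hS : S.noiseCov.PosDef)
    (hG : ∀ k, Differentiable ℝ fun u => S.forward u k) (γr γp : ℝ) (v : S.White) :
    sγ γr γp (Λ v) (V v) (S.gradΦ v) ∈ dualRange S.inclX := by
  have h : lowRank (Λ v) (V v) (fun _ => 1) (S.gradΦ v) ∈ dualRange S.inclX := by
    refine S.lowRank_mem_dualRange _ fun i => ?_
    by_cases hi : Λ v i = 0
    · left
      rw [hΛV.eigenvalue_eq] at hi
      rw [real_inner_comm, inner_gradΦ_eq_zero hG (eq_zero_of_inner_noisePrec hS hi), mul_zero]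
    · exact Or.inr (hΛV.mem_dualRange hi)
  exact Submodule.add_mem _ (Submodule.smul_mem _ _ h)
    (Submodule.smul_mem _ _ (Submodule.sub_mem _ (gradΦ_mem v) h))

theorem ghat_mem (hΛV : S.IsLeadingEigenpairs r Λ V) (hS : S.noiseCov.PosDef)
    (hG : ∀ k, Differentiable ℝ fun u => S.forward u k) (γr γp : ℝ) (v : S.White) :
    S.ghat Λ V γr γp v ∈ dualRange S.inclX := by
  have h := Submodule.add_mem _ (Submodule.neg_mem _ (hΛV.lowRankW_mem (f := fun t => t) rfl v v))
    (hΛV.sγ_mem hS hG γr γp v)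
  exact Submodule.neg_mem _ (Submodule.add_mem _ h (hΛV.lowRank_mem (by simp [D_zero]) v _))

theorem KhatInvSqrt_ghat_mem (hΛV : S.IsLeadingEigenpairs r Λ V) (hS : S.noiseCov.PosDef)
    (hG : ∀ k, Differentiable ℝ fun u => S.forward u k) (γr γp : ℝ) (v : S.White) :
    KhatInvSqrt (Λ v) (V v) (S.ghat Λ V γr γp v) ∈ dualRange S.inclX :=
  Submodule.add_mem _ (hΛV.ghat_mem hS hG γr γp v) (hΛV.lowRank_mem (by simp [D_zero]) v _)

end IsLeadingEigenpairs

/-! ### Measurability -/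

section Measurability

theorem measurable_Φ (hG : ∀ k, Differentiable ℝ fun u => S.forward u k) : Measurable S.Φ := by
  have h := (differentiable_forward hG).continuous
  have hc : Continuous S.Φ := by
    unfold Φ potential
    fun_prop
  exact hc.measurable

theorem _root_.DRMala.measurable_D : Measurable D := by
  unfold D
  fun_prop

variable [MeasurableSpace X] [BorelSpace X]

theorem measurable_gradΦ : Measurable S.gradΦ := by
  have h1 : Measurable fun v => fderiv ℝ S.potential (S.unwhiten v) :=
    (measurable_fderiv ℝ S.potential).comp S.unwhiten.continuous.measurable
  have h2 : Continuous fun T : SobolevSeq S.ℓ →L[ℝ] ℝ =>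
      (InnerProductSpace.toDual ℝ X).symm (T ∘L S.sqrtCovX) := by fun_prop
  exact h2.measurable.comp h1

variable [TopologicalSpace.SeparableSpace X] {Ω : Type*} [MeasurableSpace Ω]

theorem measurable_jac {v : Ω → S.White} {x : Ω → X} (hv : Measurable v) (hx : Measurable x) :
    Measurable fun ω => S.jac (v ω) (x ω) := by
  have : SecondCountableTopology X := UniformSpace.secondCountable_of_separable X
  have h1 : Measurable fun ω => fderiv ℝ S.forward (S.unwhiten (v ω)) :=
    (measurable_fderiv ℝ S.forward).comp (S.unwhiten.continuous.measurable.comp hv)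
  have h2 : Measurable fun ω => S.sqrtCovX (x ω) := S.sqrtCovX.continuous.measurable.comp hx
  have h3 : Continuous fun p : (SobolevSeq S.ℓ →L[ℝ] EuclideanSpace ℝ (Fin m)) × SobolevSeq S.ℓ =>
      p.1 p.2 := isBoundedBilinearMap_apply.continuous
  exact h3.measurable.comp (h1.prodMk h2)

/-- Measurability of `f ⟨x, w⟩`, where the pairing need only converge if `f ≠ 0`. -/
theorem measurable_mul_pair {f : Ω → ℝ} {x : Ω → X} {w : Ω → S.White} (hf : Measurable f)
    (hx : Measurable x) (hw : Measurable w) (h : ∀ ω, f ω = 0 ∨ x ω ∈ dualRange S.inclX) :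
    Measurable fun ω => f ω * P.pair (x ω) (w ω) := by
  have : SecondCountableTopology X := UniformSpace.secondCountable_of_separable X
  refine measurable_of_tendsto_metrizable
    (f := fun n ω => f ω * ∑ j ∈ Finset.range n, ⟪P.basis j, x ω⟫ * w ω j) (fun n => ?_)
    (tendsto_pi_nhds.2 fun ω => ?_)
  · have hc : ∀ j, Measurable fun ω => w ω j := fun j =>
      (continuous_apply (S.ℓ - P.κ) j).measurable.comp hw
    fun_prop
  · rcases h ω with h0 | ⟨φ, hφ⟩
    · simp [h0]
    · rw [S.pair_eq hφ]
      exact (S.hasSum_pair hφ (w ω)).tendsto_sum_nat.const_mul _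

namespace IsLeadingEigenpairs

variable (hΛV : S.IsLeadingEigenpairs r Λ V) (hV : ∀ i, Measurable fun v => V v i)

include hΛV hV

/-- Only the eigenvectors are assumed to depend measurably on `v`; the Rayleigh quotient transfers
this to the eigenvalues. -/
theorem measurable_eigenvalue (i : Fin r) : Measurable fun v => Λ v i := by
  simp_rw [hΛV.eigenvalue_eq]
  have := measurable_jac (S := S) measurable_id (hV i)
  exact this.inner (S.noisePrec.continuous.measurable.comp this)

theorem measurable_lowRank {f : ℝ → ℝ} (hf : Measurable f) {v : Ω → S.White} {x : Ω → X}
    (hv : Measurable v) (hx : Measurable x) :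
    Measurable fun ω => lowRank (Λ (v ω)) (V (v ω)) f (x ω) := by
  have : SecondCountableTopology X := UniformSpace.secondCountable_of_separable X
  have hVv : ∀ i, Measurable fun ω => V (v ω) i := fun i => (hV i).comp hv
  have hΛv : ∀ i, Measurable fun ω => Λ (v ω) i := fun i =>
    (hΛV.measurable_eigenvalue hV i).comp hv
  exact Finset.measurable_fun_sum _ fun i _ =>
    ((hf.comp (hΛv i)).mul ((hVv i).inner hx)).smul (hVv i)

theorem measurable_lowRankW {f : ℝ → ℝ} (hf : Measurable f) (hf0 : f 0 = 0)
    {v w : Ω → S.White} (hv : Measurable v) (hw : Measurable w) :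
    Measurable fun ω => S.lowRankW (Λ (v ω)) (V (v ω)) f (w ω) := by
  have : SecondCountableTopology X := UniformSpace.secondCountable_of_separable X
  have hVv : ∀ i, Measurable fun ω => V (v ω) i := fun i => (hV i).comp hv
  have hΛv : ∀ i, Measurable fun ω => Λ (v ω) i := fun i =>
    (hΛV.measurable_eigenvalue hV i).comp hv
  have hp : ∀ i, Measurable fun ω => f (Λ (v ω) i) * P.pair (V (v ω) i) (w ω) := fun i =>
    measurable_mul_pair (hf.comp (hΛv i)) (hVv i) hw fun ω => by
      by_cases hi : Λ (v ω) i = 0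
      · left; simp [hi, hf0]
      · exact Or.inr (hΛV.mem_dualRange hi)
  unfold lowRankW
  fun_prop

theorem measurable_sγ (γr γp : ℝ) :
    Measurable fun v => sγ γr γp (Λ v) (V v) (S.gradΦ v) := by
  have : SecondCountableTopology X := UniformSpace.secondCountable_of_separable X
  have h := hΛV.measurable_lowRank hV (f := fun _ => 1) measurable_const measurable_id
    measurable_gradΦ
  have hg := measurable_gradΦ (S := S)
  unfold sγ
  exact (h.const_smul γr).add ((hg.sub h).const_smul γp)

theorem measurable_Khat {x : S.White → X} (hx : Measurable x) :
    Measurable fun v => Khat (Λ v) (V v) (x v) := by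
  have : SecondCountableTopology X := UniformSpace.secondCountable_of_separable X
  exact hx.add (hΛV.measurable_lowRank hV (measurable_D.sub_const 1) measurable_id hx)

theorem measurable_ghat (γr γp : ℝ) : Measurable (S.ghat Λ V γr γp) := by
  have : SecondCountableTopology X := UniformSpace.secondCountable_of_separable X
  have h1 := hΛV.measurable_lowRankW hV (f := fun t => t) measurable_id rfl measurable_id
    measurable_id
  exact (hΛV.measurable_Khat hV (h1.neg.add (hΛV.measurable_sγ hV γr γp))).neg

theorem measurable_KhatInvSqrt_ghat (γr γp : ℝ) :
    Measurable fun v => KhatInvSqrt (Λ v) (V v) (S.ghat Λ V γr γp v) := by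
  have : SecondCountableTopology X := UniformSpace.secondCountable_of_separable X
  have hg := hΛV.measurable_ghat hV γr γp
  exact hg.add (hΛV.measurable_lowRank hV (measurable_D.sqrt.inv.sub_const 1) measurable_id hg)

theorem measurable_proposal (h γr γp : ℝ) :
    Measurable fun p : S.White × S.White => S.proposal Λ V h γr γp p.1 p.2 := by
  have hJ : Measurable S.inclX := S.inclX.continuous.measurable
  have h1 : Measurable fun p : S.White × S.White =>
      S.lowRankW (Λ p.1) (V p.1) (fun t => D t - 1) p.1 :=
    hΛV.measurable_lowRankW hV (measurable_D.sub_const 1) (by simp [D_zero]) measurable_fst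
      measurable_fst
  have h2 : Measurable fun p : S.White × S.White =>
      Khat (Λ p.1) (V p.1) (sγ γr γp (Λ p.1) (V p.1) (S.gradΦ p.1)) :=
    (hΛV.measurable_Khat hV (hΛV.measurable_sγ hV γr γp)).comp measurable_fst
  have h3 : Measurable fun p : S.White × S.White =>
      S.lowRankW (Λ p.1) (V p.1) (fun t => √(D t) - 1) p.2 :=
    hΛV.measurable_lowRankW hV (measurable_D.sqrt.sub_const 1) (by simp [D_zero]) measurable_fst
      measurable_snd
  unfold proposal KhatSqrtW
  fun_prop

theorem measurable_proposal_left (h γr γp : ℝ) (v : S.White) :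
    Measurable (S.proposal Λ V h γr γp v) :=
  Measurable.of_uncurry_left (f := S.proposal Λ V h γr γp) (hΛV.measurable_proposal hV h γr γp)

theorem measurable_lam (hS : S.noiseCov.PosDef)
    (hG : ∀ k, Differentiable ℝ fun u => S.forward u k) (h γr γp : ℝ) :
    Measurable fun p : S.White × S.White => S.lam Λ V h γr γp p.2 p.1 := by
  have : SecondCountableTopology X := UniformSpace.secondCountable_of_separable X
  have hk := (hΛV.measurable_KhatInvSqrt_ghat hV γr γp).comp
    (measurable_fst : Measurable (Prod.fst : S.White × S.White → S.White))
  have hw : Measurable fun p : S.White × S.White => S.KhatInvSqrtW (Λ p.1) (V p.1) p.2 :=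
    measurable_snd.add (S.inclX.continuous.measurable.comp (hΛV.measurable_lowRankW hV
      (measurable_D.sqrt.inv.sub_const 1) (by simp [D_zero]) measurable_fst measurable_snd))
  have h1 := measurable_mul_pair (measurable_const (a := √h / 2)) hk hw
    fun p => Or.inr (hΛV.KhatInvSqrt_ghat_mem hS hG γr γp p.1)
  have h2 := measurable_mul_pair (measurable_const (a := -(1 / 2 : ℝ)))
    (hΛV.measurable_lowRankW hV (f := fun t => t) measurable_id rfl measurable_fst measurable_snd)
    (measurable_snd (α := S.White)) fun p => Or.inr (hΛV.lowRankW_mem rfl p.1 p.2)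
  have h3 : Measurable fun p : S.White × S.White => detKhatInvSqrt (Λ p.1) := by
    have hΛv : ∀ i, Measurable fun p : S.White × S.White => Λ p.1 i := fun i =>
      (hΛV.measurable_eigenvalue hV i).comp measurable_fst
    simp_rw [detKhatInvSqrt, Matrix.det_diagonal]
    exact Finset.measurable_fun_prod _ fun i _ => (measurable_D.comp (hΛv i)).sqrt.inv
  exact ((((hk.norm.pow_const 2).const_mul _).add h1).exp.mul h2.exp).mul h3

/-- The proposal as a Markov kernel. -/
theorem exists_kernel (h γr γp : ℝ) : ∃ Q : Kernel S.White S.White, IsMarkovKernel Q ∧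
    ∀ v, Q v = S.prior.map (S.proposal Λ V h γr γp v) := by
  have hp := hΛV.measurable_proposal hV h γr γp
  refine ⟨(Kernel.id ×ₖ Kernel.const S.White S.prior).map
    fun p : S.White × S.White => S.proposal Λ V h γr γp p.1 p.2, Kernel.IsMarkovKernel.map _ hp,
    fun v => ?_⟩
  rw [Kernel.map_apply _ hp, Kernel.prod_apply, Kernel.id_apply, Kernel.const_apply,
    Measure.dirac_prod, Measure.map_map hp measurable_prodMk_left]
  rfl

end IsLeadingEigenpairs

end Measurability

end InverseProblem

/-! ### Joint laws and transposes as densities over a reference law -/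

theorem compProd_eq_withDensity {α : Type*} [MeasurableSpace α] {μ : Measure α} [SFinite μ]
    {c : ℝ≥0∞} {a : α → ℝ≥0∞} (ha : Measurable a) [SFinite (c • μ.withDensity a)]
    {Q : Kernel α α} [IsSFiniteKernel Q] {T : α × α → α} (hT : Measurable T)
    {l k : α × α → ℝ≥0∞} (hl : Measurable l) (hk : Measurable k)
    (hQ : ∀ v (g : α → ℝ≥0∞), Measurable g →
      ∫⁻ v', g v' ∂Q v = ∫⁻ w, g (T (v, w)) * l (v, w) ∂μ)
    (hkl : ∀ v w, k (v, T (v, w)) = c * (a v * l (v, w))) :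
    (c • μ.withDensity a) ⊗ₘ Q =
      ((μ.prod μ).map fun p => (p.1, T p)).withDensity k := by
  refine Measure.ext_of_lintegral _ fun g hg => ?_
  have hin : Measurable fun v => ∫⁻ v', g (v, v') ∂Q v := hg.lintegral_kernel_prod_right'
  have hG : Measurable fun p : α × α => (p.1, T p) := measurable_fst.prodMk hT
  rw [lintegral_withDensity_eq_lintegral_mul _ hk hg, lintegral_map (hk.mul hg) hG,
    lintegral_prod (fun p => (k * g) (p.1, T p)) ((hk.mul hg).comp hG).aemeasurable, Measure.lintegral_compProd hg,
    lintegral_smul_measure, lintegral_withDensity_eq_lintegral_mul _ ha hin, smul_eq_mul,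
    ← lintegral_const_mul _ (ha.mul hin)]
  refine lintegral_congr fun v => ?_
  have h1 : Measurable fun w => g (v, T (v, w)) * l (v, w) :=
    ((hg.comp hG).mul hl).comp measurable_prodMk_left
  rw [Pi.mul_apply, hQ v (fun v' => g (v, v')) (hg.comp measurable_prodMk_left), ← mul_assoc,
    ← lintegral_const_mul _ h1]
  refine lintegral_congr fun w => ?_
  simp only [Pi.mul_apply, hkl]
  ring

/-- By symmetry of `η`, transposing the measure replaces the density `f p` by `f p.swap`; strict
positivity of `f` allows the quotient. -/
theorem map_swap_withDensity {α : Type*} [MeasurableSpace α] {η : Measure (α × α)}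
    (hη : η.map Prod.swap = η) (c : ℝ≥0∞) {f : α × α → ℝ} (hf : Measurable f)
    (hpos : ∀ p, 0 < f p) :
    (η.withDensity fun p => c * ENNReal.ofReal (f p)).map Prod.swap =
      (η.withDensity fun p => c * ENNReal.ofReal (f p)).withDensity
        fun p => ENNReal.ofReal (f p.swap / f p) := by
  have hd : Measurable fun p => c * ENNReal.ofReal (f p) := by fun_prop
  have hf' : Measurable fun p : α × α => f p.swap := hf.comp measurable_swap
  have hq : Measurable fun p : α × α => ENNReal.ofReal (f p.swap / f p) := by fun_prop
  rw [← withDensity_mul _ hd hq]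
  refine Measure.ext_of_lintegral _ fun g hg => ?_
  have hg' : Measurable fun p : α × α => g p.swap := hg.comp measurable_swap
  rw [lintegral_map hg measurable_swap, lintegral_withDensity_eq_lintegral_mul _ hd hg',
    lintegral_withDensity_eq_lintegral_mul _ (hd.mul hq) hg]
  conv_rhs => rw [← hη]
  rw [lintegral_map ((hd.mul hq).mul hg) measurable_swap]
  refine lintegral_congr fun p => ?_
  simp only [Pi.mul_apply, Prod.swap_swap]
  rw [mul_assoc c (ENNReal.ofReal _) (ENNReal.ofReal _), ← ENNReal.ofReal_mul (hpos _).le,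
    mul_div_cancel₀ _ (hpos p.swap).ne']

namespace InverseProblem

variable {X : Type*} [NormedAddCommGroup X] [InnerProductSpace ℝ X] [CompleteSpace X]
  {P : PolyDecayPrior X} {m : ℕ} {S : InverseProblem P m}

/-! ### The posterior -/

theorem measurable_exp_neg_Φ (hG : ∀ k, Differentiable ℝ fun u => S.forward u k) :
    Measurable fun v => ENNReal.ofReal (Real.exp (-S.Φ v)) :=
  (measurable_Φ hG).neg.exp.ennreal_ofReal

theorem evidence_pos (hG : ∀ k, Differentiable ℝ fun u => S.forward u k) : 0 < S.evidence := by
  refine pos_iff_ne_zero.2 fun h => ?_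
  rw [evidence, lintegral_eq_zero_iff (measurable_exp_neg_Φ hG)] at h
  obtain ⟨v, hv⟩ := h.exists
  exact (ENNReal.ofReal_pos.2 (Real.exp_pos _)).ne' hv

theorem evidence_lt_top (hS : S.noiseCov.PosDef) : S.evidence < ⊤ := by
  refine lt_of_le_of_lt (b := ∫⁻ _, 1 ∂S.prior) (lintegral_mono fun v => ?_) (by simp)
  rw [← ENNReal.ofReal_one]
  exact ENNReal.ofReal_le_ofReal (Real.exp_le_one_iff.2 (neg_nonpos.2 (Φ_nonneg hS v)))

theorem isProbabilityMeasure_posterior (hS : S.noiseCov.PosDef)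
    (hG : ∀ k, Differentiable ℝ fun u => S.forward u k) : IsProbabilityMeasure S.posterior := by
  constructor
  rw [posterior, Measure.smul_apply, withDensity_apply _ MeasurableSet.univ, Measure.restrict_univ]
  exact ENNReal.inv_mul_cancel (evidence_pos hG).ne' (evidence_lt_top hS).ne

/-! ### The reference law of the position and the proposal -/

variable (S) in
/-- The law of `(v, ρ₀ v + ρ₂ w)` for independent `v, w ∼ N(0, I)`. -/
def referenceJoint (h : ℝ) : Measure (S.White × S.White) :=
  (S.prior.prod S.prior).map fun p => (p.1, ρ₀ h • p.1 + ρ₂ h • p.2)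

/-- The reflection with `a = ρ₀`, `b = ρ₂` sends `v` to `v' = ρ₀ v + ρ₂ w`, and the new proposal is
`(ρ₀² + ρ₂²) v = v`. -/
theorem map_swap_referenceJoint {h : ℝ} (hh : 0 < h) :
    (S.referenceJoint h).map Prod.swap = S.referenceJoint h := by
  conv_rhs => rw [referenceJoint, ← S.isWhite_prior.map_reflection (ρ₀_sq_add_ρ₂_sq hh)]
  rw [referenceJoint, Measure.map_map (by fun_prop) (by fun_prop),
    Measure.map_map (by fun_prop) (by fun_prop)]
  congr 1
  funext p
  refine Prod.ext rfl ?_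
  change p.1 = ρ₀ h • (ρ₀ h • p.1 + ρ₂ h • p.2) + ρ₂ h • (ρ₂ h • p.1 - ρ₀ h • p.2)
  conv_lhs => rw [← one_smul ℝ p.1, ← ρ₀_sq_add_ρ₂_sq hh]
  module

theorem wstar_eq {h : ℝ} (hh : 0 < h) (v w : S.White) :
    S.wstar h v (ρ₀ h • v + ρ₂ h • w) = w := by
  rw [wstar, add_sub_cancel_left, inv_smul_smul₀ (ρ₂_pos hh).ne']

namespace IsLeadingEigenpairs

variable {r : ℕ} {Λ : S.White → Fin r → ℝ} {V : S.White → Fin r → X}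
  (hΛV : S.IsLeadingEigenpairs r Λ V) (hS : S.noiseCov.PosDef)
  (hG : ∀ k, Differentiable ℝ fun u => S.forward u k)

include hΛV hS

theorem kap_pos (h γr γp : ℝ) (v v' : S.White) : 0 < S.kap Λ V h γr γp v v' := by
  have hd : 0 < detKhatInvSqrt (Λ v) := by
    rw [detKhatInvSqrt, Matrix.det_diagonal]
    exact Finset.prod_pos fun i _ => inv_pos.2 (sqrt_D_pos (hΛV.eigenvalue_nonneg hS v i))
  unfold kap lam
  positivity

include hG

/-- The representing functionals may be chosen separately for each `v`, without measurability,
because the identity is pointwise in `v` and its right side no longer mentions them. -/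
theorem lintegral_proposal {h : ℝ} (hh : 0 < h) (γr γp : ℝ) (v : S.White)
    {g : S.White → ℝ≥0∞} (hg : Measurable g) :
    ∫⁻ ξ, g (S.proposal Λ V h γr γp v ξ) ∂S.prior =
      ∫⁻ w, g (ρ₀ h • v + ρ₂ h • w) * ENNReal.ofReal (S.lam Λ V h γr γp w v) ∂S.prior := by
  obtain ⟨φ, hφ⟩ := hΛV.exists_represents v
  simp_rw [proposal_eq S hh γr γp (hΛV.eigenvalue_nonneg hS v) (hΛV.orthonormal v)]
  exact hasDensity_KhatSqrtW (hΛV.eigenvalue_nonneg hS v) (hΛV.orthonormal v) hφ hh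
    (hΛV.KhatInvSqrt_ghat_mem hS hG γr γp v) (fun w => g (ρ₀ h • v + ρ₂ h • w)) (by fun_prop)

variable [TopologicalSpace.SeparableSpace X] [MeasurableSpace X] [BorelSpace X]
  (hV : ∀ i, Measurable fun v => V v i)

include hV

theorem measurable_kap (h γr γp : ℝ) :
    Measurable fun p : S.White × S.White => S.kap Λ V h γr γp p.1 p.2 := by
  have h1 : Measurable fun p : S.White × S.White => S.wstar h p.1 p.2 := by
    unfold wstar
    fun_prop
  have h2 := (hΛV.measurable_lam hV hS hG h γr γp).comp (measurable_fst.prodMk h1)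
  exact ((measurable_Φ hG).comp measurable_fst).neg.exp.mul h2

/-- The density is needed only on pairs `(v, ρ₀ v + ρ₂ w)`, where `w^* = w`; there `κ` is the
product of the posterior weight `exp(-Φ)` and `λ(w; v)`. -/
theorem joint_eq_withDensity {h : ℝ} (hh : 0 < h) (γr γp : ℝ) {Q : Kernel S.White S.White}
    [IsMarkovKernel Q] (hQ : ∀ v, Q v = S.prior.map (S.proposal Λ V h γr γp v)) :
    S.joint Q = (S.referenceJoint h).withDensity fun p =>
      S.evidence⁻¹ * ENNReal.ofReal (S.kap Λ V h γr γp p.1 p.2) := by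
  have hprob : IsProbabilityMeasure (S.evidence⁻¹ • S.prior.withDensity fun v =>
      ENNReal.ofReal (Real.exp (-S.Φ v))) := isProbabilityMeasure_posterior hS hG
  rw [joint, posterior, referenceJoint]
  refine compProd_eq_withDensity (measurable_exp_neg_Φ hG)
    (T := fun p => ρ₀ h • p.1 + ρ₂ h • p.2) (by fun_prop)
    (l := fun p => ENNReal.ofReal (S.lam Λ V h γr γp p.2 p.1))
    (hΛV.measurable_lam hV hS hG h γr γp).ennreal_ofReal
    ((hΛV.measurable_kap hS hG hV h γr γp).ennreal_ofReal.const_mul _) (fun v g hg => ?_)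
    fun v w => ?_
  · rw [hQ v, lintegral_map hg (hΛV.measurable_proposal_left hV h γr γp v), hΛV.lintegral_proposal hS hG hh γr γp v hg]
  · rw [kap, wstar_eq hh, ENNReal.ofReal_mul (Real.exp_nonneg _)]

theorem map_swap_joint {h : ℝ} (hh : 0 < h) (γr γp : ℝ) {Q : Kernel S.White S.White}
    [IsMarkovKernel Q] (hQ : ∀ v, Q v = S.prior.map (S.proposal Λ V h γr γp v)) :
    (S.joint Q).map Prod.swap = (S.joint Q).withDensity fun p =>
      ENNReal.ofReal (S.kap Λ V h γr γp p.2 p.1 / S.kap Λ V h γr γp p.1 p.2) := by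
  rw [hΛV.joint_eq_withDensity hS hG hV hh γr γp hQ]
  exact map_swap_withDensity (map_swap_referenceJoint hh) _
    (f := fun p => S.kap Λ V h γr γp p.1 p.2) (hΛV.measurable_kap hS hG hV h γr γp)
    fun p => hΛV.kap_pos hS h γr γp p.1 p.2

end IsLeadingEigenpairs

end InverseProblem

end DRMala

end

/-! ### Equivalence of the two laws and the acceptance probability -/

theorem mainTheorem1 {X : Type*} [NormedAddCommGroup X] [InnerProductSpace ℝ X] [CompleteSpace X]
    [TopologicalSpace.SeparableSpace X] [MeasurableSpace X] [BorelSpace X]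
    (P : DRMala.PolyDecayPrior X) {m : ℕ} (S : DRMala.InverseProblem P m)
    (hS : S.noiseCov.PosDef)
    (hG : ∀ k, Differentiable ℝ fun u => S.forward u k)
    {r : ℕ} (Λ : S.White → Fin r → ℝ) (V : S.White → Fin r → X)
    (hΛV : S.IsLeadingEigenpairs r Λ V) (hV : ∀ i, Measurable fun v => V v i)
    (h : ℝ) (hh : 0 < h) (γr γp : ℝ) (hγr : γr = 0 ∨ γr = 1) (hγp : γp = 0 ∨ γp = 1) :
    -- the law of `u = C^{1/2} v` under the prior is the Gaussian measure `N(0, C)` on `X`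
    IsProbabilityMeasure S.prior ∧
    (∀ t : X, charFun (S.prior.map S.unwhitenX) t = Complex.exp (-(inner ℝ t (P.cov t) / 2 : ℝ))) ∧
    -- the posterior is a well-defined probability measure
    0 < S.evidence ∧ S.evidence < ⊤ ∧ IsProbabilityMeasure S.posterior ∧
    -- the pairings in the proposal and in the acceptance probability converge
    (∀ v w : S.White,
      (∀ i, Λ v i ≠ 0 → Summable fun j => inner ℝ (P.basis j) (V v i) * w j) ∧
      Summable fun j =>
        inner ℝ (P.basis j)
          (DRMala.InverseProblem.KhatInvSqrt (Λ v) (V v) (S.ghat Λ V γr γp v)) *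
          S.KhatInvSqrtW (Λ v) (V v) w j) ∧
    -- the proposal is a Markov kernel `Q`; the law `ν(dv, dv') = μ(dv) Q(v, dv')` and its transpose
    -- are equivalent, in the coordinates `v` as well as on `X × X` in the coordinates `u`; and the
    -- acceptance probability `1 ∧ dνᵀ/dν` is `a(v, v')`
    ∃ Q : Kernel S.White S.White, IsMarkovKernel Q ∧
      (∀ v, AEMeasurable (S.proposal Λ V h γr γp v) S.prior ∧
        Q v = S.prior.map (S.proposal Λ V h γr γp v)) ∧
      S.joint Q ≪ (S.joint Q).map Prod.swap ∧
      (S.joint Q).map Prod.swap ≪ S.joint Q ∧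
      S.jointX Q ≪ (S.jointX Q).map Prod.swap ∧
      (S.jointX Q).map Prod.swap ≪ S.jointX Q ∧
      ∀ᵐ p ∂(S.joint Q),
        min 1 (((S.joint Q).map Prod.swap).rnDeriv (S.joint Q) p).toReal
          = S.accept Λ V h γr γp p.1 p.2 := by
  have hprob := DRMala.InverseProblem.isProbabilityMeasure_posterior hS hG
  refine ⟨inferInstance, S.charFun_map_unwhitenX, DRMala.InverseProblem.evidence_pos hG,
    DRMala.InverseProblem.evidence_lt_top hS, hprob, fun v w => ⟨fun i hi => ?_, ?_⟩, ?_⟩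
  · obtain ⟨φ, hφ⟩ := hΛV.mem_dualRange hi
    exact (S.hasSum_pair hφ w).summable
  · obtain ⟨φ, hφ⟩ := hΛV.KhatInvSqrt_ghat_mem hS hG γr γp v
    exact (S.hasSum_pair hφ _).summable
  obtain ⟨Q, hM, hQ⟩ := hΛV.exists_kernel hV h γr γp
  have : SecondCountableTopology X := UniformSpace.secondCountable_of_separable X
  have hsw := hΛV.map_swap_joint hS hG hV hh γr γp hQ
  have hac : (S.joint Q).map Prod.swap ≪ S.joint Q := by
    rw [hsw]
    exact withDensity_absolutelyContinuous _ _
  have hac' : S.joint Q ≪ (S.joint Q).map Prod.swap := by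
    -- Transposition is an involution, so applying it to one absolute continuity gives the other.
    have h1 := hac.map (f := Prod.swap) measurable_swap
    rwa [Measure.map_map measurable_swap measurable_swap, Prod.swap_swap_eq, Measure.map_id] at h1
  have hu : Measurable (Prod.map S.unwhitenX S.unwhitenX) :=
    S.unwhitenX.continuous.measurable.prodMap S.unwhitenX.continuous.measurable
  -- Transposition commutes with applying `C^{1/2}` to both components, so the equivalence on `X ×
  -- X` is an image of the one already proved.
  have hX : (S.jointX Q).map Prod.swap =
      ((S.joint Q).map Prod.swap).map (Prod.map S.unwhitenX S.unwhitenX) := by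
    rw [DRMala.InverseProblem.jointX, Measure.map_map measurable_swap hu,
      Measure.map_map hu measurable_swap]
    rfl
  refine ⟨Q, hM, fun v => ⟨(hΛV.measurable_proposal_left hV h γr γp v).aemeasurable, hQ v⟩, hac', hac, ?_, ?_,
    ?_⟩
  · rw [hX]
    exact hac'.map hu
  · rw [hX]
    exact hac.map hu
  · have hk := hΛV.measurable_kap hS hG hV h γr γp
    have hfin : IsProbabilityMeasure (S.joint Q) := by
      unfold DRMala.InverseProblem.joint
      infer_instance
    rw [hsw]
    filter_upwards [Measure.rnDeriv_withDensity (S.joint Q)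
      ((hk.comp measurable_swap).div hk).ennreal_ofReal] with p hp
    have h1 := hΛV.kap_pos hS h γr γp p.1 p.2
    have h2 := hΛV.kap_pos hS h γr γp p.2 p.1
    refine congrArg (min 1) ((congrArg ENNReal.toReal hp).trans ?_)
    exact ENNReal.toReal_ofReal (div_pos h2 h1).le
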